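/- Let $G$ be a finite simple graph. A set $S\subseteq V(G)$ is \emph{$P_3$-closed} if every vertex $x\notin S$ satisfies $|N(x)\cap S|<2$, and the hull $\sigma(A)$ of $A\subseteq V(G)$ is the intersection of all $P_3$-closed sets containing $A$. In the \emph{connected $P_3$-game} on $G$ all vertices are initially unlabeled. Two players move alternately; if $L$ is the current set of labeled vertices, a legal move is the selection of an unlabeled vertex $x$ such that $\sigma(L\cup\{x\})$ induces a connected subgraph of $G$, and $\sigma(L\cup\{x\})$ becomes the new set of labeled vertices. A player who has no legal move loses. The Grundy value of a position is the least nonnegative integer that is not the Grundy value of a position reachable from it in one legal move. A \emph{cactus} is a graph without the diamond ($K_4$ minus an edge) as a minor; equivalently, a graph each of whose biconnected components is an edge or a cycle. \textbf{Theorem.} There exists a polynomial-time algorithm that decides the connected $P_3$-game on cacti. That is, there are an algorithm (a program for a random access machine with addition, subtraction and indirect addressing as unit-cost operations) and a polynomial $p$ such that, for every cactus $G$ with $n$ vertices given by its adjacency matrix, the algorithm halts after at most $p(n)$ steps and tells which one of the two players has a winning strategy in the connected $P_3$-game on $G$; moreover it outputs the Grundy value of the initial position. -/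

import Mathlib

/-! ### Cacti -/

section Graphs

variable {V W : Type*}

/-- `H` is a minor of `G`: there are pairwise disjoint sets of vertices of `G` (branch sets), one for
each vertex of `H`, each inducing a (nonempty) connected subgraph of `G`, such that for every edge
of `H` there is an edge of `G` between the two corresponding branch sets. -/
def IsGraphMinor (H : SimpleGraph W) (G : SimpleGraph V) : Prop :=
  ∃ B : W → Set V,
    (∀ w, (G.induce (B w)).Connected) ∧
    (∀ w w', w ≠ w' → Disjoint (B w) (B w')) ∧
    (∀ w w', H.Adj w w' → ∃ x ∈ B w, ∃ y ∈ B w', G.Adj x y)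

/-- The diamond: the complete graph on four vertices minus one edge. -/
def diamond : SimpleGraph (Fin 4) :=
  (⊤ : SimpleGraph (Fin 4)).deleteEdges {s(0, 1)}

/-- A cactus is a graph without the diamond as a minor. -/
def IsCactus (G : SimpleGraph V) : Prop :=
  ¬ IsGraphMinor diamond G

end Graphs

/-! ### The connected `P₃`-game -/

namespace P3Game

section Game

variable {V : Type*} (G : SimpleGraph V)

/-- A set `S` is `P₃`-closed if every vertex outside `S` has fewer than two neighbours in `S`. -/
def Closed (S : Set V) : Prop :=
  ∀ x, x ∉ S → (G.neighborSet x ∩ S).encard < 2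

/-- The hull `σ(A)`: the intersection of all `P₃`-closed sets that contain `A`. -/
def hull (A : Set V) : Set V :=
  ⋂₀ {K | Closed G K ∧ A ⊆ K}

/-- The labeled set `σ(L + x)` after the selection of `x` when `L` is the set of labeled vertices. -/
def play (L : Set V) (x : V) : Set V :=
  hull G (insert x L)

/-- In the connected game, the selection of `x` is legal if `x` is unlabeled and the new set of
labeled vertices induces a connected subgraph. -/
def Legal (L : Set V) (x : V) : Prop :=
  x ∉ L ∧ (G.induce (play G L x)).Connected

/-- The player to move from the labeled set `L` has a winning strategy: there is a legal move after
which, whatever legal answer the opponent gives (possibly there is none), the player again has a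
winning strategy. A player who has no legal move loses. -/
inductive MoverWins : Set V → Prop
  | move {L : Set V} (x : V) (hx : Legal G L x)
      (h : ∀ y, Legal G (play G L x) y → MoverWins (play G (play G L x) y)) : MoverWins L

/-- Player one has a winning strategy in the game that starts with all vertices unlabeled. -/
def PlayerOneWins : Prop :=
  MoverWins G ∅

/-- Player two has a winning strategy in the game that starts with all vertices unlabeled. -/
def PlayerTwoWins : Prop :=
  ∀ x, Legal G ∅ x → MoverWins G (play G ∅ x)

theorem insert_subset_play (L : Set V) (x : V) : insert x L ⊆ play G L x :=
  Set.subset_sInter fun _ hK => hK.2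

theorem ncard_compl_play_lt [Finite V] {L : Set V} {x : V} (hx : Legal G L x) :
    (play G L x)ᶜ.ncard < Lᶜ.ncard := by
  refine Set.ncard_lt_ncard ?_ (Set.toFinite _)
  refine ⟨Set.compl_subset_compl.2 ((Set.subset_insert x L).trans (insert_subset_play G L x)), ?_⟩
  intro h
  exact h hx.1 (insert_subset_play G L x (Set.mem_insert x L))

/-- The Grundy value of the position with labeled set `L`: the least natural number that is not the
Grundy value of a position that can be reached in one legal move. -/
noncomputable def grundy [Finite V] (L : Set V) : ℕ :=
  sInf {m : ℕ | ∀ (x : V) (_ : Legal G L x), grundy (play G L x) ≠ m}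
termination_by Lᶜ.ncard
decreasing_by exact ncard_compl_play_lt G ‹_›

end Game

end P3Game

/-! ### A random access machine with a step count

Programs use natural-number registers and two-dimensional arrays (hence indirect addressing), each
program only finitely many of them. The arithmetic operations are addition and truncated subtraction.
There is no multiplication, so the bit length of the largest stored number grows by at most a constant
in each step, and unit-cost time on this machine is polynomially related to Turing machine time. -/

namespace RAM

/-- The memory: registers `reg i` and array cells `arr a i j`. -/
structure Memory where
  reg : ℕ → ℕ
  arr : ℕ → ℕ → ℕ → ℕ

/-- Expressions. `get a e f` reads the array `a` at the indices `e`, `f`. -/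
inductive Term
  | const (k : ℕ)
  | reg (i : ℕ)
  | get (a : ℕ) (e f : Term)
  | plus (e f : Term)
  | minus (e f : Term)

/-- The value of an expression. -/
def Term.eval (m : Memory) : Term → ℕ
  | .const k => k
  | .reg i => m.reg i
  | .get a e f => m.arr a (e.eval m) (f.eval m)
  | .plus e f => e.eval m + f.eval m
  | .minus e f => e.eval m - f.eval m

/-- The number of steps that the evaluation of an expression takes: one for each constant, register
access, array access and arithmetic operation in it. -/
def Term.cost : Term → ℕ
  | .const _ => 1
  | .reg _ => 1
  | .get _ e f => e.cost + f.cost + 1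
  | .plus e f => e.cost + f.cost + 1
  | .minus e f => e.cost + f.cost + 1

/-- Programs. A test `e` counts as true if its value is not `0`. -/
inductive Program
  | skip
  | assign (i : ℕ) (e : Term)
  | put (a : ℕ) (e f g : Term)
  | seq (P Q : Program)
  | cond (e : Term) (P Q : Program)
  | loop (e : Term) (P : Program)

/-- `m.setReg i v` is `m` with the value `v` in register `i`. -/
def Memory.setReg (m : Memory) (i v : ℕ) : Memory :=
  { m with reg := fun i' => if i' = i then v else m.reg i' }

/-- `m.setArr a i j v` is `m` with the value `v` in the cell `i`, `j` of array `a`. -/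
def Memory.setArr (m : Memory) (a i j v : ℕ) : Memory :=
  { m with arr := fun a' i' j' => if a' = a ∧ i' = i ∧ j' = j then v else m.arr a' i' j' }

/-- `Exec P m t m'`: the program `P`, started in the memory `m`, halts after exactly `t` steps in the
memory `m'`. -/
inductive Exec : Program → Memory → ℕ → Memory → Prop
  | skip (m : Memory) : Exec .skip m 1 m
  | assign (m : Memory) (i : ℕ) (e : Term) :
      Exec (.assign i e) m (e.cost + 1) (m.setReg i (e.eval m))
  | put (m : Memory) (a : ℕ) (e f g : Term) :
      Exec (.put a e f g) m (e.cost + f.cost + g.cost + 1)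
        (m.setArr a (e.eval m) (f.eval m) (g.eval m))
  | seq {P Q : Program} {m m' m'' : Memory} {t t' : ℕ} :
      Exec P m t m' → Exec Q m' t' m'' → Exec (.seq P Q) m (t + t' + 1) m''
  | cond_true {e : Term} {P Q : Program} {m m' : Memory} {t : ℕ} :
      e.eval m ≠ 0 → Exec P m t m' → Exec (.cond e P Q) m (e.cost + t + 1) m'
  | cond_false {e : Term} {P Q : Program} {m m' : Memory} {t : ℕ} :
      e.eval m = 0 → Exec Q m t m' → Exec (.cond e P Q) m (e.cost + t + 1) m'
  | loop_true {e : Term} {P : Program} {m m' m'' : Memory} {t t' : ℕ} :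
      e.eval m ≠ 0 → Exec P m t m' → Exec (.loop e P) m' t' m'' →
        Exec (.loop e P) m (e.cost + t + t' + 1) m''
  | loop_false {e : Term} {P : Program} {m : Memory} :
      e.eval m = 0 → Exec (.loop e P) m (e.cost + 1) m

open Classical in
/-- The initial memory for the input graph `G` with vertices `0, …, n - 1`: register `0` holds `n`,
array `0` holds the adjacency matrix of `G`, and everything else is `0`. -/
noncomputable def input {n : ℕ} (G : SimpleGraph (Fin n)) : Memory where
  reg := fun i => if i = 0 then n else 0
  arr := fun a i j => if a = 0 ∧ ∃ u v : Fin n, G.Adj u v ∧ u.val = i ∧ v.val = j then 1 else 0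

end RAM

/-! In a closed connected position `L`, selecting an unlabeled `x` is legal exactly when `x` is
within distance two of `L` (`legal_iff`): a farther `x` leaves `L + x` closed and disconnected,
while for a near `x` the hull grows by vertices attached to what is already there. Legality becomes
the local condition `Move`, which also makes sense for disconnected labeled sets. The Grundy value
`value` for these moves agrees with `grundy` on closed connected positions (`grundy_eq_value`). By
locality, a nonempty closed position whose unlabeled part splits into two parts without edges
between them is a sum of games, and its value is a nim sum (`value_compl_union`).

In a cactus only few components of the unlabeled part can occur. If such a component had three
labeled neighbours, closedness would give them distinct neighbours in the component; cutting the
component into three connected parts and contracting them and the connected labeled set yields a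
diamond minor. So there are at most two labeled neighbours `u₁`, `u₂` (`Solid.exists_pair`), and the
component is that of some `v` in the graph without `u₁` and `u₂` (`reach_pair`). Thus `n ^ 3`
triples index all components.

A dynamic program fills the table of these triples in the order of component size
(`valueTable_iterArr`): try every move, compute the hull and the new components, look up their
values, form the nim sum and take the minimal excludant. Values are at most the number of unlabeled
vertices (`value_le`), so a small table of nim sums suffices; it is computed by its mex recursion.

On the machine, `Comp` is closed under arithmetic, branching and `n`-fold iteration of numbers and
of whole arrays. Its time bound depends on `n` alone and not on the stored values, so nesting keeps
it polynomial; programs compose because each of them preserves everything below its thresholds `r`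
and `b`. -/

namespace RAM

/-! ### Halting with a time bound and a postcondition -/

/-- Started in `m`, the program `P` halts after at most `k` steps in a memory that satisfies `Φ`. -/
def Halts (P : Program) (m : Memory) (k : ℕ) (Φ : Memory → Prop) : Prop :=
  ∃ t m', Exec P m t m' ∧ t ≤ k ∧ Φ m'

namespace Halts

variable {P Q : Program} {m : Memory} {k k' : ℕ} {Φ Ψ : Memory → Prop}

theorem mono (h : Halts P m k Φ) (hk : k ≤ k') (hΦ : ∀ m', Φ m' → Ψ m') : Halts P m k' Ψ := by
  obtain ⟨t, m', he, ht, hm⟩ := h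
  exact ⟨t, m', he, ht.trans hk, hΦ _ hm⟩

theorem seq (h : Halts P m k Φ) (h' : ∀ m', Φ m' → Halts Q m' k' Ψ) :
    Halts (.seq P Q) m (k + k' + 1) Ψ := by
  obtain ⟨t, m', he, ht, hm⟩ := h
  obtain ⟨t', m'', he', ht', hm'⟩ := h' m' hm
  exact ⟨_, m'', .seq he he', by omega, hm'⟩

theorem assign {i : ℕ} {e : Term} (h : Φ (m.setReg i (e.eval m))) :
    Halts (.assign i e) m (e.cost + 1) Φ :=
  ⟨_, _, .assign m i e, le_rfl, h⟩

theorem put {a : ℕ} {e f g : Term} (h : Φ (m.setArr a (e.eval m) (f.eval m) (g.eval m))) :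
    Halts (.put a e f g) m (e.cost + f.cost + g.cost + 1) Φ :=
  ⟨_, _, .put m a e f g, le_rfl, h⟩

/-- The bounds of the branches are added: a sum of polynomials is a polynomial, a maximum need not
be one. -/
theorem cond {e : Term} (h : e.eval m ≠ 0 → Halts P m k Φ) (h' : e.eval m = 0 → Halts Q m k' Φ) :
    Halts (.cond e P Q) m (e.cost + (k + k') + 1) Φ := by
  by_cases he : e.eval m = 0
  · obtain ⟨t, m', hE, ht, hm⟩ := h' he
    exact ⟨_, m', .cond_false he hE, by omega, hm⟩
  · obtain ⟨t, m', hE, ht, hm⟩ := h he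
    exact ⟨_, m', .cond_true he hE, by omega, hm⟩

end Halts

/-- The program `for c < reg 0 do P`. -/
def Program.forLoop (c : ℕ) (P : Program) : Program :=
  .seq (.assign c (.const 0))
    (.loop (.minus (.reg 0) (.reg c)) (.seq P (.assign c (.plus (.reg c) (.const 1)))))

/-- Induction on the number `j` of remaining rounds. A round costs `k` for the body, 4 for the
increment, 3 for the test and 1 each for the sequence and the loop; the final failing test costs 4.
The truncated difference is nonzero exactly while the counter is below `n`. -/
theorem Halts.loop_of_invariant {c n k : ℕ} {P : Program} {I : ℕ → Memory → Prop}
    (hP : ∀ i < n, ∀ m, I i m → m.reg 0 = n → m.reg c = i →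
      Halts P m k fun m' => m'.reg 0 = n ∧ m'.reg c = i ∧ I (i + 1) (m'.setReg c (i + 1)))
    (hc : c ≠ 0) (j : ℕ) :
    ∀ i m, i + j = n → I i m → m.reg 0 = n → m.reg c = i →
      Halts (.loop (.minus (.reg 0) (.reg c)) (.seq P (.assign c (.plus (.reg c) (.const 1))))) m
        (j * (k + 9) + 4) (fun m' => m'.reg 0 = n ∧ I n m') := by
  induction j with
  | zero =>
    intro i m hi hI h0 hic
    refine ⟨_, m, .loop_false ?_, ?_, h0, ?_⟩
    · simp [Term.eval, h0, hic]; omega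
    · simp [Term.cost]
    · have : i = n := by omega
      rwa [← this]
  | succ j ih =>
    intro i m hi hI h0 hic
    obtain ⟨t, m', he, ht, h0', hc', hI'⟩ := hP i (by omega) m hI h0 hic
    obtain ⟨t', m'', he', ht', hm''⟩ := ih (i + 1) (m'.setReg c (i + 1)) (by omega) hI'
      (by simpa [Memory.setReg, hc.symm] using h0') (by simp [Memory.setReg])
    refine ⟨_, m'', .loop_true (t' := t') ?_ (.seq he (.assign _ _ _)) ?_, ?_, hm''⟩
    · simp [Term.eval, h0, hic]; omega
    · simpa [Term.eval, hc'] using he'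
    · simp only [Term.cost]; rw [Nat.succ_mul]; omega

theorem Halts.forLoop {c n k : ℕ} {P : Program} (I : ℕ → Memory → Prop) {m : Memory}
    (hc : c ≠ 0) (h0 : m.reg 0 = n) (hI : I 0 (m.setReg c 0))
    (hP : ∀ i < n, ∀ m, I i m → m.reg 0 = n → m.reg c = i →
      Halts P m k fun m' => m'.reg 0 = n ∧ m'.reg c = i ∧ I (i + 1) (m'.setReg c (i + 1))) :
    Halts (.forLoop c P) m (n * (k + 9) + 7) (fun m' => m'.reg 0 = n ∧ I n m') := by
  refine (Halts.seq (Φ := fun m' => m' = m.setReg c 0) (Halts.assign rfl) ?_).mono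
    (show (Term.const 0).cost + 1 + (n * (k + 9) + 4) + 1 ≤ _ by simp [Term.cost]; omega)
    fun _ h => h
  rintro _ rfl
  exact Halts.loop_of_invariant hP hc n 0 _ (by simp) hI
    (by simpa [Memory.setReg, hc.symm] using h0) (by simp [Memory.setReg])

/-! ### Functions that are computable in polynomial time -/

/-- The stream that starts with `x` and continues with `f`. -/
def cons {α : Type*} (x : α) (f : ℕ → α) : ℕ → α
  | 0 => x
  | i + 1 => f i

theorem cons_lt {x k : ℕ} {f : ℕ → ℕ} (hx : x < k) (hf : ∀ i, f i < k) : ∀ i, cons x f i < k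
  | 0 => hx
  | i + 1 => hf i

theorem cons_ne {x k : ℕ} {f : ℕ → ℕ} (hx : x ≠ k) (hf : ∀ i, f i ≠ k) : ∀ i, cons x f i ≠ k
  | 0 => hx
  | i + 1 => hf i

/-- The arguments of a function: a size, an adjacency matrix, and stacks of numbers and of
three-dimensional arrays. -/
structure Env where
  n : ℕ
  adj : ℕ → ℕ → ℕ
  var : ℕ → ℕ
  arr : ℕ → ℕ → ℕ → ℕ → ℕ

/-- Push a number. -/
def Env.push (e : Env) (x : ℕ) : Env := { e with var := cons x e.var }

/-- Push an array. -/
def Env.pushArr (e : Env) (A : ℕ → ℕ → ℕ → ℕ) : Env := { e with arr := cons A e.arr }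

section
variable (e : Env) (x : ℕ) (A : ℕ → ℕ → ℕ → ℕ)
@[simp] theorem Env.push_n : (e.push x).n = e.n := rfl
@[simp] theorem Env.push_arr : (e.push x).arr = e.arr := rfl
@[simp] theorem Env.push_var_zero : (e.push x).var 0 = x := rfl
@[simp] theorem Env.push_var_one : (e.push x).var 1 = e.var 0 := rfl
@[simp] theorem Env.push_var_two : (e.push x).var 2 = e.var 1 := rfl
@[simp] theorem Env.pushArr_n : (e.pushArr A).n = e.n := rfl
end

/-- The memory `m` holds `e`, with the number `i` in register `ρ i` and the array `a` in the array
`α a`, where the cell `x`, `y`, `z` is stored at `x * n + y`, `z`. -/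
structure Represents (ρ α : ℕ → ℕ) (e : Env) (m : Memory) : Prop where
  size : m.reg 0 = e.n
  adj : ∀ i j, m.arr 0 i j = e.adj i j
  var : ∀ i, m.reg (ρ i) = e.var i
  arr : ∀ a, ∀ x < e.n, ∀ y < e.n, ∀ z < e.n, m.arr (α a) (x * e.n + y) z = e.arr a x y z

/-- The two memories agree on the registers below `r` and on the arrays in `s`. -/
def Agree (r : ℕ) (s : Set ℕ) (m m' : Memory) : Prop :=
  (∀ i < r, m'.reg i = m.reg i) ∧ ∀ a ∈ s, m'.arr a = m.arr a

theorem Agree.refl (r : ℕ) (s : Set ℕ) (m : Memory) : Agree r s m m :=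
  ⟨fun _ _ => rfl, fun _ _ => rfl⟩

theorem Agree.trans {r : ℕ} {s : Set ℕ} {m m' m'' : Memory} (h : Agree r s m m')
    (h' : Agree r s m' m'') : Agree r s m m'' :=
  ⟨fun i hi => (h'.1 i hi).trans (h.1 i hi), fun a ha => (h'.2 a ha).trans (h.2 a ha)⟩

theorem Agree.mono {r r' : ℕ} {s s' : Set ℕ} {m m' : Memory} (h : Agree r s m m') (hr : r' ≤ r)
    (hs : s' ⊆ s) : Agree r' s' m m' :=
  ⟨fun i hi => h.1 i (hi.trans_le hr), fun a ha => h.2 a (hs ha)⟩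

theorem Agree.setReg {r : ℕ} {s : Set ℕ} {m m' : Memory} (h : Agree r s m m') {i v : ℕ}
    (hi : r ≤ i) : Agree r s m (m'.setReg i v) :=
  ⟨fun j hj => by simpa [Memory.setReg, (hj.trans_le hi).ne] using h.1 j hj, h.2⟩

theorem Agree.setArr {r : ℕ} {s : Set ℕ} {m m' : Memory} (h : Agree r s m m') {a i j v : ℕ}
    (ha : a ∉ s) : Agree r s m (m'.setArr a i j v) := by
  refine ⟨h.1, fun c hc => ?_⟩
  have : c ≠ a := by rintro rfl; exact ha hc
  simpa [Memory.setArr, this] using h.2 c hc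

theorem Represents.agree {ρ α : ℕ → ℕ} {e : Env} {m m' : Memory} {r : ℕ} {s : Set ℕ}
    (h : Represents ρ α e m) (hm : Agree r s m m') (hr : 0 < r) (hρ : ∀ i, ρ i < r)
    (hs : 0 ∈ s) (hα : ∀ a, α a ∈ s) : Represents ρ α e m' where
  size := by rw [hm.1 0 hr, h.size]
  adj i j := by rw [hm.2 0 hs, h.adj]
  var i := by rw [hm.1 _ (hρ i), h.var]
  arr a x hx y hy z hz := by rw [hm.2 _ (hα a), h.arr a x hx y hy z hz]

theorem Represents.push {ρ α : ℕ → ℕ} {e : Env} {m : Memory} (h : Represents ρ α e m) {r x : ℕ}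
    (hx : m.reg r = x) : Represents (cons r ρ) α (e.push x) m where
  size := h.size
  adj := h.adj
  var := by rintro (_ | i); exacts [hx, h.var i]
  arr := h.arr

theorem Represents.pushArr {ρ α : ℕ → ℕ} {e : Env} {m : Memory} (h : Represents ρ α e m) {b : ℕ}
    {A : ℕ → ℕ → ℕ → ℕ} (hA : ∀ x < e.n, ∀ y < e.n, ∀ z < e.n, m.arr b (x * e.n + y) z = A x y z) :
    Represents ρ (cons b α) (e.pushArr A) m where
  size := h.size
  adj := h.adj
  var := h.var
  arr := by rintro (_ | i); exacts [hA, h.arr i]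

/-- `F` is computable in polynomial time: for each layout of the arguments in the memory, there is a
program that writes the value of `F` into register `r` and does not change the registers below `r`
and the arrays below `b`. -/
def Comp (F : Env → ℕ) : Prop :=
  ∀ (ρ α : ℕ → ℕ) (r b : ℕ), 0 < r → (∀ i, ρ i < r) → 0 < b → (∀ a, α a < b) →
    ∃ (P : Program) (q : Polynomial ℕ), ∀ e m, Represents ρ α e m →
      Halts P m (q.eval e.n) fun m' => m'.reg r = F e ∧ Agree r (Set.Iio b) m m'

open Polynomial in
theorem Comp.of_term {F : Env → ℕ} (T : (ℕ → ℕ) → Term)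
    (h : ∀ ρ α e m, Represents ρ α e m → (T ρ).eval m = F e) : Comp F := by
  intro ρ α r b hr hρ hb hα
  refine ⟨.assign r (T ρ), C ((T ρ).cost + 1), fun e m hm => ?_⟩
  rw [eval_C]
  refine Halts.assign ⟨?_, (Agree.refl _ _ _).setReg le_rfl⟩
  simp [Memory.setReg, h _ _ _ _ hm]

theorem Comp.const (k : ℕ) : Comp fun _ => k :=
  .of_term (fun _ => .const k) fun _ _ _ _ _ => rfl

theorem Comp.size : Comp fun e => e.n :=
  .of_term (fun _ => .reg 0) fun _ _ _ _ h => h.size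

theorem Comp.var (i : ℕ) : Comp fun e => e.var i :=
  .of_term (fun ρ => .reg (ρ i)) fun _ _ _ _ h => h.var i

open Polynomial in
/-- Two computable functions can be combined by a term. -/
theorem Comp.binary {F G H : Env → ℕ} (hF : Comp F) (hG : Comp G) (T : (ℕ → ℕ) → ℕ → ℕ → Term)
    (h : ∀ ρ α e m r s, Represents ρ α e m → m.reg r = F e → m.reg s = G e →
      (T α r s).eval m = H e) : Comp H := by
  intro ρ α r b hr hρ hb hα
  obtain ⟨P, p, hP⟩ := hF ρ α r b hr hρ hb hα
  -- The raised threshold `r + 1` protects the first result, which sits in register `r`.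
  obtain ⟨Q, q, hQ⟩ := hG ρ α (r + 1) b (by omega) (fun i => (hρ i).trans r.lt_succ_self) hb hα
  refine ⟨.seq P (.seq Q (.assign r (T α r (r + 1)))),
    p + (q + C ((T α r (r + 1)).cost + 1) + 1) + 1, fun e m hm => ?_⟩
  simp only [eval_add, eval_C, eval_one]
  refine (hP e m hm).seq ?_
  rintro m' ⟨h1, h2⟩
  have hm' := hm.agree h2 hr hρ hb hα
  refine (hQ e m' hm').seq ?_
  rintro m'' ⟨h3, h4⟩
  have hm'' := hm'.agree (h4.mono r.le_succ subset_rfl) hr hρ hb hα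
  refine Halts.assign ⟨?_, (h2.trans (h4.mono r.le_succ subset_rfl)).setReg le_rfl⟩
  simp [Memory.setReg, h _ _ _ _ r (r + 1) hm'' (by rw [h4.1 r r.lt_succ_self, h1]) h3]

theorem Comp.add {F G : Env → ℕ} (hF : Comp F) (hG : Comp G) : Comp fun e => F e + G e :=
  hF.binary hG (fun _ r s => .plus (.reg r) (.reg s)) fun _ _ _ _ _ _ _ h h' => by
    simp [Term.eval, h, h']

theorem Comp.sub {F G : Env → ℕ} (hF : Comp F) (hG : Comp G) : Comp fun e => F e - G e :=
  hF.binary hG (fun _ r s => .minus (.reg r) (.reg s)) fun _ _ _ _ _ _ _ h h' => by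
    simp [Term.eval, h, h']

theorem Comp.adj {F G : Env → ℕ} (hF : Comp F) (hG : Comp G) : Comp fun e => e.adj (F e) (G e) :=
  hF.binary hG (fun _ r s => .get 0 (.reg r) (.reg s)) fun _ _ _ _ _ _ hm h h' => by
    simp [Term.eval, h, h', hm.adj]

open Classical in
/-- The predicate `Q` is decidable in polynomial time. -/
def CompPred (Q : Env → Prop) : Prop :=
  Comp fun e => if Q e then 1 else 0

-- The first branch need only be correct where `Q` holds. Array access relies on this, since
-- `Represents` says nothing about cells out of range.
open Polynomial in
theorem Comp.ite {Q : Env → Prop} [DecidablePred Q] {F G : Env → ℕ} (hQ : CompPred Q)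
    (hF : ∀ ρ α r b, 0 < r → (∀ i, ρ i < r) → 0 < b → (∀ a, α a < b) →
      ∃ (P : Program) (q : Polynomial ℕ), ∀ e m, Represents ρ α e m → Q e →
        Halts P m (q.eval e.n) fun m' => m'.reg r = F e ∧ Agree r (Set.Iio b) m m')
    (hG : Comp G) : Comp fun e => if Q e then F e else G e := by
  intro ρ α r b hr hρ hb hα
  obtain ⟨P₁, p₁, h₁⟩ := hQ ρ α r b hr hρ hb hα
  obtain ⟨P₂, p₂, h₂⟩ := hF ρ α r b hr hρ hb hα
  obtain ⟨P₃, p₃, h₃⟩ := hG ρ α r b hr hρ hb hα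
  refine ⟨.seq P₁ (.cond (.reg r) P₂ P₃), p₁ + (1 + (p₂ + p₃) + 1) + 1, fun e m hm => ?_⟩
  simp only [eval_add, eval_one]
  refine (h₁ e m hm).seq ?_
  rintro m' ⟨h4, h5⟩
  have hm' := hm.agree h5 hr hρ hb hα
  refine Halts.cond (fun h => ?_) fun h => ?_
  · have hq : Q e := by
      by_contra hq
      exact h (by simpa [Term.eval, hq] using h4)
    refine (h₂ e m' hm' hq).mono le_rfl ?_
    rintro m'' ⟨h6, h7⟩
    exact ⟨by simp [hq, h6], h5.trans h7⟩
  · have hq : ¬ Q e := by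
      intro hq
      simp [Term.eval, h4, hq] at h
    refine (h₃ e m' hm').mono le_rfl ?_
    rintro m'' ⟨h6, h7⟩
    exact ⟨by simp [hq, h6], h5.trans h7⟩

/-- Renaming of the arguments. -/
theorem Comp.rename {F : Env → ℕ} (hF : Comp F) (f g : ℕ → ℕ) :
    Comp fun e => F { e with var := fun i => e.var (f i), arr := fun a => e.arr (g a) } := by
  intro ρ α r b hr hρ hb hα
  obtain ⟨P, p, hP⟩ := hF (fun i => ρ (f i)) (fun a => α (g a)) r b hr (fun _ => hρ _) hb
    fun _ => hα _
  refine ⟨P, p, fun e m hm => hP { e with var := fun i => e.var (f i), arr := fun a => e.arr (g a) } m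
    ⟨hm.size, hm.adj, fun i => hm.var _, fun a => hm.arr _⟩⟩

/-- Bounded iteration: `S` is applied for `i = 0, …, n - 1` with `i` and the current value as its
topmost arguments. -/
def Env.iter (F S : Env → ℕ) (e : Env) (k : ℕ) : ℕ :=
  Nat.rec (F e) (fun i x => S ((e.push i).push x)) k

-- Register `r` carries the current value, `r + 1` the counter, and `r + 2` receives the result of
-- the step. The bound `q` for one step is uniform in the current value, hence `n` rounds stay
-- polynomial.
open Polynomial in
theorem Comp.iter {F S : Env → ℕ} (hF : Comp F) (hS : Comp S) :
    Comp fun e => e.iter F S e.n := by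
  intro ρ α r b hr hρ hb hα
  obtain ⟨P, p, hP⟩ := hF ρ α r b hr hρ hb hα
  obtain ⟨Q, q, hQ⟩ := hS (cons r (cons (r + 1) ρ)) α (r + 2) b (by omega)
    (cons_lt (by omega) (cons_lt (by omega) fun i => (hρ i).trans (by omega))) hb hα
  refine ⟨.seq P (.forLoop (r + 1) (.seq Q (.assign r (.reg (r + 2))))),
    p + (X * (q + 2 + 1 + 9) + 7) + 1, fun e m hm => ?_⟩
  simp only [eval_add, eval_mul, eval_X, eval_ofNat, eval_one]
  refine (hP e m hm).seq ?_
  rintro m₁ ⟨h1, h2⟩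
  refine (Halts.forLoop (fun i m' => m'.reg r = e.iter F S i ∧ Agree r (Set.Iio b) m m')
    r.succ_ne_zero (by rw [h2.1 0 hr, hm.size]) ⟨?_, h2.setReg r.le_succ⟩ ?_).mono le_rfl
    fun m' h => h.2
  · simpa [Memory.setReg, Env.iter] using h1
  rintro i hi m₂ ⟨h3, h4⟩ h5 h6
  refine (hQ ((e.push i).push (e.iter F S i)) m₂
    (((hm.agree h4 hr hρ hb hα).push h6).push h3)).seq ?_
  rintro m₃ ⟨h7, h8⟩
  refine Halts.assign ⟨?_, ?_, ?_, ?_⟩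
  · simp [Memory.setReg, hr.ne, h8.1 0 (by omega), h5]
  · simp [Memory.setReg, h8.1 (r + 1) (by omega), h6]
  · simp [Memory.setReg, Term.eval, h7, Env.iter]
  · exact ((h4.trans (h8.mono (by omega) subset_rfl)).setReg le_rfl).setReg r.le_succ

/-- Repeated addition replaces the missing multiplication; the product is needed for the row address
`x * n + y`. -/
theorem Comp.mul_size {F : Env → ℕ} (hF : Comp F) : Comp fun e => F e * e.n := by
  have h := Comp.iter (Comp.const 0) ((Comp.var 0).add (hF.rename (· + 2) id))
  convert h using 2 with e
  have : ∀ k, e.iter (fun _ => 0) (fun e => e.var 0 +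
      F { e with var := fun i => e.var (i + 2), arr := fun a => e.arr (id a) }) k = F e * k := by
    intro k
    induction k with
    | zero => rfl
    | succ k ih =>
      rw [Nat.mul_succ, ← ih]
      rfl
  exact (this _).symm

/-! ### Predicates that are decidable in polynomial time -/

theorem Comp.cond {Q : Env → Prop} [DecidablePred Q] {F G : Env → ℕ} (hQ : CompPred Q) (hF : Comp F) (hG : Comp G) :
    Comp fun e => if Q e then F e else G e := by
  refine Comp.ite hQ (fun ρ α r b hr hρ hb hα => ?_) hG
  obtain ⟨P, p, hP⟩ := hF ρ α r b hr hρ hb hα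
  exact ⟨P, p, fun e m hm _ => hP e m hm⟩

namespace CompPred

variable {Q R : Env → Prop} {F G : Env → ℕ}

open Classical in
theorem pos (hF : Comp F) : CompPred fun e => 0 < F e := by
  -- Truncated subtraction applied twice turns a number into its sign.
  have h := (Comp.const 1).sub ((Comp.const 1).sub hF)
  unfold CompPred
  convert h using 2 with e
  split <;> omega

open Classical in
theorem not (hQ : CompPred Q) : CompPred fun e => ¬ Q e := by
  have h := Comp.cond hQ (Comp.const 0) (Comp.const 1)
  unfold CompPred
  convert h using 2 with e
  by_cases hq : Q e <;> simp [hq]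

open Classical in
theorem and (hQ : CompPred Q) (hR : CompPred R) : CompPred fun e => Q e ∧ R e := by
  have h := Comp.cond hQ hR (Comp.const 0)
  unfold CompPred
  convert h using 2 with e
  by_cases hq : Q e <;> simp [hq]

theorem congr (hQ : CompPred Q) (h : ∀ e, Q e ↔ R e) : CompPred R := by
  have : Q = R := funext fun e => propext (h e)
  rwa [← this]

theorem or (hQ : CompPred Q) (hR : CompPred R) : CompPred fun e => Q e ∨ R e :=
  (hQ.not.and hR.not).not.congr fun e => by tauto

theorem imp (hQ : CompPred Q) (hR : CompPred R) : CompPred fun e => Q e → R e :=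
  (hQ.and hR.not).not.congr fun e => by tauto

theorem lt (hF : Comp F) (hG : Comp G) : CompPred fun e => F e < G e :=
  (pos (hG.sub hF)).congr fun e => by omega

theorem eq (hF : Comp F) (hG : Comp G) : CompPred fun e => F e = G e :=
  ((lt hF hG).not.and (lt hG hF).not).congr fun e => by omega

open Classical in
theorem exists_lt (hQ : CompPred Q) : CompPred fun e => ∃ i < e.n, Q (e.push i) := by
  -- In the iteration the flag lies above the counter; the shift by one hides the flag.
  have hQ' : CompPred fun e =>
    Q { e with var := fun i => e.var (i + 1), arr := fun a => e.arr (id a) } :=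
    Comp.rename hQ (· + 1) id
  have h := Comp.iter (Comp.const 0) (Comp.cond hQ' (Comp.const 1) (Comp.var 0))
  unfold CompPred
  convert h using 2 with e
  have : ∀ k, e.iter (fun _ => 0) (fun e => if Q { e with
      var := fun i => e.var (i + 1), arr := fun a => e.arr (id a) } then 1 else e.var 0) k =
      if ∃ i < k, Q (e.push i) then 1 else 0 := by
    intro k
    induction k with
    | zero => simp [Env.iter]
    | succ k ih =>
      have hs : e.iter (fun _ => 0) (fun e => if Q { e with
        var := fun i => e.var (i + 1), arr := fun a => e.arr (id a) } then 1 else e.var 0) (k + 1) =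
        if Q (e.push k) then 1 else e.iter (fun _ => 0) (fun e => if Q { e with
          var := fun i => e.var (i + 1), arr := fun a => e.arr (id a) } then 1 else e.var 0) k := rfl
      rw [hs, ih]
      by_cases hk : Q (e.push k)
      · rw [if_pos hk, if_pos ⟨k, k.lt_succ_self, hk⟩]
      · rw [if_neg hk]
        congr 1
        refine propext ⟨fun ⟨i, hi, h⟩ => ⟨i, by omega, h⟩, fun ⟨i, hi, h⟩ => ⟨i, ?_, h⟩⟩
        rcases Nat.lt_succ_iff_lt_or_eq.1 hi with hi | rfl
        exacts [hi, absurd h hk]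
  rw [this]
  congr

theorem forall_lt (hQ : CompPred Q) : CompPred fun e => ∀ i < e.n, Q (e.push i) :=
  hQ.not.exists_lt.not.congr fun e => by push Not; rfl

end CompPred

/-! ### Arrays -/

open Polynomial in
/-- Array access. -/
theorem Comp.arr (a : ℕ) {F G H : Env → ℕ} (hF : Comp F) (hG : Comp G) (hH : Comp H) :
    Comp fun e => if (F e < e.n ∧ G e < e.n ∧ H e < e.n) then e.arr a (F e) (G e) (H e) else 0 := by
  refine Comp.ite ((CompPred.lt hF .size).and ((CompPred.lt hG .size).and (CompPred.lt hH .size)))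
    (fun ρ α r b hr hρ hb hα => ?_) (Comp.const 0)
  obtain ⟨P, p, hP⟩ := (hF.mul_size.add hG) ρ α r b hr hρ hb hα
  obtain ⟨Q, q, hQ⟩ := hH ρ α (r + 1) b r.succ_pos (fun i => (hρ i).trans r.lt_succ_self) hb hα
  refine ⟨.seq P (.seq Q (.assign r (.get (α a) (.reg r) (.reg (r + 1))))),
    p + (q + C 4 + 1) + 1, fun e m hm hn => ?_⟩
  simp only [eval_add, eval_C, eval_one]
  refine (hP e m hm).seq ?_
  rintro m' ⟨h1, h2⟩
  have hm' := hm.agree h2 hr hρ hb hα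
  refine (hQ e m' hm').seq ?_
  rintro m'' ⟨h3, h4⟩
  have hm'' := hm'.agree (h4.mono r.le_succ subset_rfl) hr hρ hb hα
  refine Halts.assign ⟨?_, (h2.trans (h4.mono r.le_succ subset_rfl)).setReg le_rfl⟩
  simp only [Memory.setReg, if_true, Term.eval, h3, h4.1 r r.lt_succ_self, h1]
  exact hm''.arr a _ hn.1 _ hn.2.1 _ hn.2.2

/-- The program that writes the values computed by `P` into the array `τ`. -/
def Program.fill (r τ : ℕ) (P : Program) : Program :=
  .seq (.assign (r + 3) (.const 0))
    (.forLoop r (.forLoop (r + 1)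
      (.seq (.forLoop (r + 2) (.seq P (.put τ (.reg (r + 3)) (.reg (r + 2)) (.reg (r + 4)))))
        (.assign (r + 3) (.plus (.reg (r + 3)) (.const 1))))))

-- Registers `r`, `r + 1`, `r + 2` run through the three indices, and `r + 3` counts the rows, so
-- the address is updated by increments. Since no argument array is stored in `τ`, overwriting it
-- does not disturb the evaluation of `F`.
open Polynomial in
theorem Comp.fill {F : Env → ℕ} (hF : Comp F) (ρ α : ℕ → ℕ) (r b τ : ℕ) (hr : 0 < r)
    (hρ : ∀ i, ρ i < r) (hb : 0 < b) (hα : ∀ a, α a < b) (hτ : 0 < τ) (hτb : τ < b)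
    (hατ : ∀ a, α a ≠ τ) :
    ∃ (P : Program) (q : Polynomial ℕ), ∀ e m, Represents ρ α e m →
      Halts P m (q.eval e.n) fun m' =>
        (∀ x < e.n, ∀ y < e.n, ∀ z < e.n,
          m'.arr τ (x * e.n + y) z = F (((e.push x).push y).push z)) ∧
        Agree r (Set.Iio b \ {τ}) m m' := by
  obtain ⟨Q, q, hQ⟩ := hF (cons (r + 2) (cons (r + 1) (cons r ρ))) α (r + 4) b (by omega)
    (cons_lt (by omega) (cons_lt (by omega) (cons_lt (by omega)
      fun i => (hρ i).trans (by omega)))) hb hα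
  refine ⟨.fill r τ Q, 2 + (X * ((X * ((X * ((q + 4 + 1) + 9) + 7) + 4 + 1 + 9) + 7) + 9) + 7) + 1,
    fun e m hm => ?_⟩
  simp only [eval_add, eval_mul, eval_X, eval_ofNat, eval_one]
  set n := e.n with hn
  set s : Set ℕ := Set.Iio b \ {τ} with hs
  have h0s : 0 ∈ s := ⟨hb, hτ.ne⟩
  have hαs : ∀ a, α a ∈ s := fun a => ⟨hα a, hατ a⟩
  have hτs : τ ∉ s := fun h => h.2 rfl
  -- The invariant: all rows below `c` are complete, and so are the first `k` cells of row `c`.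
  let D : ℕ → ℕ → Memory → Prop := fun c k m' => m'.reg (r + 3) = c ∧ Agree r s m m' ∧
    ∀ x < n, ∀ y < n, ∀ z < n, (x * n + y < c ∨ x * n + y = c ∧ z < k) →
      m'.arr τ (x * n + y) z = F (((e.push x).push y).push z)
  have hD : ∀ {c k i v m'}, D c k m' → r ≤ i → i ≠ r + 3 → D c k (m'.setReg i v) := by
    rintro c k i v m' ⟨h1, h2, h3⟩ hi hi'
    exact ⟨by simpa [Memory.setReg, hi'.symm] using h1, h2.setReg hi, h3⟩
  refine (Halts.seq (Φ := D 0 0) (Halts.assign ⟨?_, ?_, ?_⟩) ?_)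
  · simp [Memory.setReg, Term.eval]
  · exact (Agree.refl _ _ _).setReg (by omega)
  · intro x hx y hy z hz h; omega
  intro m₁ h₁
  refine (Halts.forLoop (fun i => D (i * n) 0) hr.ne' (by rw [h₁.2.1.1 0 hr, hm.size])
    (by rw [zero_mul]; exact hD h₁ le_rfl (by omega)) ?_).mono le_rfl
    fun m' h => ⟨fun x hx y hy z hz => h.2.2.2 x hx y hy z hz (.inl ?_), h.2.2.1⟩
  swap
  · calc x * n + y < x * n + n := by omega
      _ = (x + 1) * n := by ring
      _ ≤ n * n := Nat.mul_le_mul_right _ hx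
  intro i hi m₂ h₂ h₂0 h₂i
  refine (Halts.forLoop (fun j m' => m'.reg r = i ∧ D (i * n + j) 0 m') (by omega) h₂0
    ⟨by simpa [Memory.setReg] using h₂i, hD h₂ (by omega) (by omega)⟩ ?_).mono le_rfl
    fun m' h => ⟨h.1, h.2.1, hD ?_ le_rfl (by omega)⟩
  swap
  · rw [add_mul, one_mul]; exact h.2.2
  rintro j hj m₃ ⟨h₃i, h₃⟩ h₃0 h₃j
  refine (Halts.seq (Φ := fun m' => m'.reg 0 = n ∧ m'.reg r = i ∧ m'.reg (r + 1) = j ∧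
    D (i * n + j) n m') (k' := 4) ?_ ?_)
  swap
  · rintro m₄ ⟨h₄0, h₄i, h₄j, h₄1, h₄2, h₄3⟩
    refine Halts.assign ⟨?_, ?_, ?_, ?_, ?_, ?_⟩
    · simpa [Memory.setReg] using h₄0
    · simpa [Memory.setReg] using h₄j
    · simpa [Memory.setReg] using h₄i
    · simp [Memory.setReg, Term.eval, h₄1, add_assoc]
    · exact (h₄2.setReg (by omega)).setReg (by omega)
    · intro x hx y hy z hz h
      refine h₄3 x hx y hy z hz ?_
      omega
  refine (Halts.forLoop (fun k m' => m'.reg r = i ∧ m'.reg (r + 1) = j ∧ D (i * n + j) k m')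
    (by omega) h₃0 ⟨?_, ?_, hD h₃ (by omega) (by omega)⟩ ?_).mono le_rfl
    fun m' h => h
  · simpa [Memory.setReg] using h₃i
  · simpa [Memory.setReg] using h₃j
  rintro k hk m₅ ⟨h₅i, h₅j, h₅1, h₅2, h₅3⟩ h₅0 h₅k
  refine Halts.seq (hQ (((e.push i).push j).push k) m₅
    ((((hm.agree h₅2 hr hρ h0s hαs).push h₅i).push h₅j).push h₅k)) ?_
  rintro m₆ ⟨h₆1, h₆2⟩
  have e0 := h₆2.1 0 (by omega)
  have e1 := h₆2.1 r (by omega)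
  have e2 := h₆2.1 (r + 1) (by omega)
  have e3 := h₆2.1 (r + 2) (by omega)
  have e4 := h₆2.1 (r + 3) (by omega)
  refine Halts.put ⟨?_, ?_, ?_, ?_, ?_, ?_, ?_⟩
  · rw [← h₅0, ← e0]; rfl
  · rw [← h₅k, ← e3]; rfl
  · simpa [Memory.setReg, Memory.setArr, e1] using h₅i
  · simpa [Memory.setReg, Memory.setArr, e2] using h₅j
  · simpa [Memory.setReg, Memory.setArr, e4] using h₅1
  · refine ((h₅2.trans (h₆2.mono (by omega) ?_)).setArr hτs).setReg (by omega)
    exact Set.sdiff_subset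
  · intro x hx y hy z hz h
    simp only [Memory.setReg, Memory.setArr, Term.eval, e3, e4, h₅1, h₅k, h₆1, true_and]
    by_cases hc : x * n + y = i * n + j ∧ z = k
    · rw [if_pos hc]
      obtain ⟨hc, rfl⟩ := hc
      -- The row number determines both indices, because `y` and `j` are below `n`.
      have hxi : x = i := by
        have h1 := congrArg (· / n) hc
        simpa [Nat.add_mul_div_right, add_comm _ y, add_comm _ j, Nat.div_eq_of_lt hy,
          Nat.div_eq_of_lt hj, (show 0 < n by omega)] using h1
      subst hxi
      have hyj : y = j := by omega
      rw [hyj]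
    · rw [if_neg hc, h₆2.2 τ hτb]
      exact h₅3 x hx y hy z hz (by omega)

/-- The array that is obtained from the initial array `I` in `k` rounds, in each of which all cells
are recomputed by `S` from the current array. -/
def Env.iterArr (I S : Env → ℕ) (e : Env) (k : ℕ) : ℕ → ℕ → ℕ → ℕ :=
  Nat.rec (fun x y z => I (((e.push x).push y).push z))
    (fun _ A x y z => S ((((e.pushArr A).push x).push y).push z)) k

-- Double buffering: array `b` holds the current round, the next one is written to `b + 1` and then
-- copied back, so that every cell is computed from the old array.
open Polynomial in
theorem Comp.iterArr {I S B : Env → ℕ} (hI : Comp I) (hS : Comp S) (hB : Comp B) :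
    Comp fun e => B (e.pushArr (e.iterArr I S e.n)) := by
  intro ρ α r b hr hρ hb hα
  have hα' : ∀ a, α a < b + 2 := fun a => (hα a).trans (by omega)
  have hρ' : ∀ i, ρ i < r + 1 := fun i => (hρ i).trans (by omega)
  have hcopy := Comp.arr 0 (.var 2) (.var 1) (.var 0)
  obtain ⟨P₁, p₁, h₁⟩ := hI.fill ρ α r (b + 2) b hr hρ (by omega) hα' hb (by omega)
    fun a => (hα a).ne
  obtain ⟨P₂, p₂, h₂⟩ := hS.fill ρ (cons b α) (r + 1) (b + 2) (b + 1) (by omega) hρ' (by omega)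
    (cons_lt (by omega) hα') (by omega) (by omega)
    (cons_ne (by omega) fun a => ((hα a).trans b.lt_succ_self).ne)
  obtain ⟨P₃, p₃, h₃⟩ := hcopy.fill ρ (cons (b + 1) α) (r + 1) (b + 2) b (by omega) hρ' (by omega)
    (cons_lt (by omega) hα') hb (by omega) (cons_ne (by omega) fun a => (hα a).ne)
  obtain ⟨P₄, p₄, h₄⟩ := hB ρ (cons b α) r (b + 1) hr hρ (by omega)
    (cons_lt (by omega) fun a => (hα a).trans (by omega))
  refine ⟨.seq P₁ (.seq (.forLoop r (.seq P₂ P₃)) P₄),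
    p₁ + ((X * (p₂ + p₃ + 1 + 9) + 7) + p₄ + 1) + 1, fun e m hm => ?_⟩
  simp only [eval_add, eval_mul, eval_X, eval_ofNat, eval_one]
  have hsub : ∀ c, b ≤ c → Set.Iio b ⊆ Set.Iio (b + 2) \ {c} := fun c hc a ha =>
    ⟨Set.mem_Iio.2 ((Set.mem_Iio.1 ha).trans (by omega)), fun h => (lt_of_lt_of_le ha hc).ne h⟩
  refine Halts.seq (h₁ e m hm) ?_
  rintro m₁ ⟨h1, h2⟩
  have h2' := h2.mono le_rfl (hsub b le_rfl)
  refine Halts.seq (Halts.forLoop (fun k m' => Agree r (Set.Iio b) m m' ∧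
    ∀ x < e.n, ∀ y < e.n, ∀ z < e.n, m'.arr b (x * e.n + y) z = e.iterArr I S k x y z) hr.ne'
    (by rw [h2.1 0 hr, hm.size]) ⟨h2'.setReg le_rfl, h1⟩ ?_) ?_
  · rintro k hk m₂ ⟨h3, h4⟩ h5 h6
    have hm₂ := hm.agree h3 hr hρ hb hα
    refine Halts.seq (h₂ (e.pushArr (e.iterArr I S k)) m₂ (hm₂.pushArr h4)) ?_
    rintro m₃ ⟨h7, h8⟩
    have h8' := h8.mono le_rfl (hsub (b + 1) (by omega))
    have hm₃ := hm₂.agree h8' (by omega) hρ' hb hα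
    refine (h₃ _ m₃ (hm₃.pushArr h7)).mono le_rfl ?_
    rintro m₄ ⟨h9, h10⟩
    have h10' := h10.mono le_rfl (hsub b le_rfl)
    refine ⟨?_, ?_, ((h3.trans (h8'.mono r.le_succ subset_rfl)).trans
      (h10'.mono r.le_succ subset_rfl)).setReg le_rfl, fun x hx y hy z hz => ?_⟩
    · rw [h10.1 0 (by omega), h8.1 0 (by omega), h5]
    · rw [h10.1 r (by omega), h8.1 r (by omega), h6]
    · refine (h9 x hx y hy z hz).trans ?_
      simp only [Env.push_n, Env.pushArr_n, Env.push_var_zero, Env.push_var_one, Env.push_var_two,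
        hx, hy, hz, and_self, if_true]
      rfl
  · rintro m₅ ⟨-, h3, h4⟩
    refine (h₄ _ m₅ ((hm.agree h3 hr hρ hb hα).pushArr h4)).mono le_rfl ?_
    rintro m₆ ⟨h5, h6⟩
    exact ⟨h5, h3.trans (h6.mono le_rfl (Set.Iio_subset_Iio b.le_succ))⟩

end RAM

/-! ### Connected induced subgraphs -/

section Connectivity

variable {V : Type*} {G : SimpleGraph V}

theorem connected_induce_insert {K : Set V} (hK : (G.induce K).Connected) {a b : V} (ha : a ∈ K)
    (hab : G.Adj a b) : (G.induce (insert b K)).Connected := by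
  have h : insert b K = K ∪ {a, b} := by
    ext z
    simp only [Set.mem_insert_iff, Set.mem_union, Set.mem_singleton_iff]
    constructor
    · tauto
    · rintro (h | rfl | h) <;> tauto
  rw [h]
  exact SimpleGraph.induce_union_connected hK.preconnected
    (SimpleGraph.induce_pair_connected_of_adj hab).preconnected ⟨a, ha, by simp⟩

theorem connected_induce_singleton (x : V) : (G.induce ({x} : Set V)).Connected := by
  have : Nonempty ({x} : Set V) := ⟨⟨x, rfl⟩⟩
  have : Subsingleton ({x} : Set V) := ⟨fun a b => Subtype.ext (a.2.trans b.2.symm)⟩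
  exact ⟨.of_subsingleton⟩

/-- An edge of a connected induced subgraph that leaves a given set. -/
theorem exists_adj_of_connected_induce {C X : Set V} (hC : (G.induce C).Connected) {a b : V}
    (ha : a ∈ C) (hb : b ∈ C) (haX : a ∈ X) (hbX : b ∉ X) :
    ∃ u ∈ C, ∃ w ∈ C, u ∈ X ∧ w ∉ X ∧ G.Adj u w := by
  obtain ⟨p⟩ := hC.preconnected ⟨a, ha⟩ ⟨b, hb⟩
  obtain ⟨d, -, h1, h2⟩ := p.exists_boundary_dart (Subtype.val ⁻¹' X) haX hbX
  exact ⟨d.fst, d.fst.2, d.snd, d.snd.2, h1, h2, d.adj⟩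

/-- A connected set with three distinguished vertices can be divided into three connected parts, each
of which contains one of them. -/
theorem exists_connected_partition [Finite V] {C : Set V} (hC : (G.induce C).Connected)
    {v : Fin 3 → V} (hv : Function.Injective v) (hvC : ∀ i, v i ∈ C) :
    ∃ S : Fin 3 → Set V, (∀ i, v i ∈ S i) ∧ (∀ i, (G.induce (S i)).Connected) ∧ (∀ i, S i ⊆ C) ∧
      (∀ i j, i ≠ j → Disjoint (S i) (S j)) ∧ ∀ x ∈ C, ∃ i, x ∈ S i := by
  let F : Set (Fin 3 → Set V) := {S | (∀ i, v i ∈ S i) ∧ (∀ i, (G.induce (S i)).Connected) ∧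
    (∀ i, S i ⊆ C) ∧ ∀ i j, i ≠ j → Disjoint (S i) (S j)}
  -- A maximal triple covers `C`: otherwise an edge of `C` leaving the union would allow one part to
  -- grow.
  obtain ⟨S, ⟨h1, h2, h3, h4⟩, hmax⟩ := F.toFinite.exists_maximal
    ⟨fun i => {v i}, fun i => rfl, fun i => connected_induce_singleton _,
      fun i => Set.singleton_subset_iff.2 (hvC i),
      fun i j hij => Set.disjoint_singleton.2 fun h => hij (hv h)⟩
  refine ⟨S, h1, h2, h3, h4, ?_⟩
  by_contra! ⟨x, hx, hxS⟩
  obtain ⟨u, -, w, hw, hu, hwS, huw⟩ := exists_adj_of_connected_induce (X := ⋃ i, S i) hC (hvC 0) hx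
    (Set.mem_iUnion.2 ⟨0, h1 0⟩) (by simpa using hxS)
  obtain ⟨i, hi⟩ := Set.mem_iUnion.1 hu
  have hwS' : ∀ j, w ∉ S j := fun j hj => hwS (Set.mem_iUnion.2 ⟨j, hj⟩)
  have hle : S ≤ Function.update S i (insert w (S i)) := by
    intro j
    rcases eq_or_ne j i with rfl | hj
    · simp [Set.subset_insert]
    · simp [hj]
  have hmem : Function.update S i (insert w (S i)) ∈ F := by
    refine ⟨fun j => hle j (h1 j), fun j => ?_, fun j => ?_, fun j k hjk => ?_⟩
    · rcases eq_or_ne j i with rfl | hj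
      · rw [Function.update_self]; exact connected_induce_insert (h2 j) hi huw
      · rw [Function.update_of_ne hj]; exact h2 j
    · rcases eq_or_ne j i with rfl | hj
      · simpa using Set.insert_subset hw (h3 j)
      · simpa [hj] using h3 j
    · rcases eq_or_ne j i with rfl | hj
      · simpa [hjk.symm, Set.disjoint_insert_left, hwS' k] using h4 j k hjk
      · rcases eq_or_ne k i with rfl | hk
        · simpa [hj, Set.disjoint_insert_right, hwS' j] using h4 j k hjk
        · simpa [hj, hk] using h4 j k hjk
  have := hmax hmem hle i (by simp : w ∈ Function.update S i (insert w (S i)) i)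
  exact hwS' i this

/-- Two disjoint connected sets with three disjoint edges (at the second set) between them give a
diamond minor. -/
theorem isGraphMinor_diamond [Finite V] {K C : Set V} (hK : (G.induce K).Connected)
    (hC : (G.induce C).Connected) (hKC : Disjoint K C) {v : Fin 3 → V} (hv : Function.Injective v)
    (hvC : ∀ i, v i ∈ C) (hvK : ∀ i, ∃ u ∈ K, G.Adj u (v i)) : IsGraphMinor diamond G := by
  obtain ⟨S, h1, h2, h3, h4, h5⟩ := exists_connected_partition hC hv hvC
  have hnbr : ∀ i, ∃ j, j ≠ i ∧ ∃ x ∈ S i, ∃ y ∈ S j, G.Adj x y := by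
    intro i
    obtain ⟨i', hi'⟩ := exists_ne i
    obtain ⟨u, -, w, hw, hu, hwS, huw⟩ := exists_adj_of_connected_induce (X := S i) hC (hvC i)
      (hvC i') (h1 i) fun h => Set.disjoint_left.1 (h4 i i' hi'.symm) h (h1 i')
    obtain ⟨j, hj⟩ := h5 w hw
    exact ⟨j, by rintro rfl; exact hwS hj, u, hu, w, hj, huw⟩
  -- A part `m` that touches both others is, with `K`, one of the two vertices of degree three of
  -- the diamond; `a` and `b` are the nonadjacent pair.
  have key : ∀ a m b : Fin 3, a ≠ m → b ≠ m → a ≠ b → (∃ x ∈ S a, ∃ y ∈ S m, G.Adj x y) →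
      (∃ x ∈ S b, ∃ y ∈ S m, G.Adj x y) → IsGraphMinor diamond G := by
    intro a m b ham hbm hab h6 h7
    have hKS : ∀ i, ∃ x ∈ K, ∃ y ∈ S i, G.Adj x y := fun i => by
      obtain ⟨u, hu, huv⟩ := hvK i
      exact ⟨u, hu, v i, h1 i, huv⟩
    have hd : ∀ i, Disjoint K (S i) := fun i => hKC.mono_right (h3 i)
    have hsymm : ∀ {X Y : Set V}, (∃ x ∈ X, ∃ y ∈ Y, G.Adj x y) → ∃ x ∈ Y, ∃ y ∈ X, G.Adj x y :=
      fun ⟨x, hx, y, hy, h⟩ => ⟨y, hy, x, hx, h.symm⟩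
    refine ⟨![S a, S b, S m, K], ?_, ?_, ?_⟩
    · intro w
      fin_cases w
      exacts [h2 a, h2 b, h2 m, hK]
    · intro w w' hw
      fin_cases w <;> fin_cases w' <;> first
        | exact absurd rfl hw
        | exact h4 _ _ ‹_›
        | exact h4 _ _ (Ne.symm ‹_›)
        | exact hd _
        | exact (hd _).symm
    · intro w w' hw
      fin_cases w <;> fin_cases w' <;> first
        | exact h6
        | exact h7
        | exact hsymm h6
        | exact hsymm h7
        | exact hKS _
        | exact hsymm (hKS _)
        | simp [diamond] at hw
  -- Part `0` touches `j`, and the third part `k` touches `0` or `j`; the one that it touches is the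
  -- middle part.
  obtain ⟨j, hj, h0⟩ := hnbr 0
  obtain ⟨k, hk0, hkj⟩ : ∃ k : Fin 3, k ≠ 0 ∧ k ≠ j := by
    clear h0
    revert j
    decide
  obtain ⟨l, hl, h6⟩ := hnbr k
  have hl' : l = 0 ∨ l = j := by
    clear h0 h6
    revert j k l
    decide
  rcases hl' with rfl | rfl
  · obtain ⟨x, hx, y, hy, h⟩ := h0
    exact key j 0 k hj hk0 hkj.symm ⟨y, hy, x, hx, h.symm⟩ h6
  · exact key 0 l k hj.symm hkj hk0.symm h0 h6

end Connectivity

/-! ### Minimal excludants -/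

/-- `m` is the least natural number that is not in `s`. -/
def IsMex (s : Set ℕ) (m : ℕ) : Prop :=
  m ∉ s ∧ ∀ k < m, k ∈ s

namespace IsMex

variable {s t : Set ℕ} {a b m : ℕ}

theorem unique (ha : IsMex s a) (hb : IsMex s b) : a = b := by
  rcases lt_trichotomy a b with h | h | h
  · exact absurd (hb.2 a h) ha.1
  · exact h
  · exact absurd (ha.2 b h) hb.1

theorem sInf_compl (hs : s.Finite) : IsMex s (sInf sᶜ) :=
  ⟨Nat.sInf_mem hs.infinite_compl.nonempty, fun k hk => not_not.1 fun h =>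
    (Nat.sInf_le (show k ∈ sᶜ from h)).not_gt hk⟩

theorem le (hm : IsMex s m) (ha : a ∉ s) : m ≤ a :=
  not_lt.1 fun h => ha (hm.2 a h)

/-- The minimal excludant that belongs to a sum of games. -/
theorem xor (ha : IsMex s a) (hb : IsMex t b) :
    IsMex {k | (∃ x ∈ s, x ^^^ b = k) ∨ ∃ y ∈ t, a ^^^ y = k} (a ^^^ b) := by
  constructor
  · rintro (⟨x, hx, h⟩ | ⟨y, hy, h⟩)
    · exact ha.1 (Nat.xor_left_injective h ▸ hx)
    · exact hb.1 (Nat.xor_right_injective h ▸ hy)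
  · intro k hk
    -- A number below a nim sum is reached by lowering one of the summands.
    rcases Nat.lt_xor_cases hk with h | h
    · exact .inl ⟨_, ha.2 _ h, by simp⟩
    · exact .inr ⟨_, hb.2 _ h, by rw [Nat.xor_comm k a, ← Nat.xor_assoc]; simp⟩

end IsMex

namespace P3Game

/-! ### Closed sets and hulls -/

section Hull

variable {V : Type*} {G : SimpleGraph V} {L A B K : Set V} {x : V}

theorem closed_iff {S : Set V} :
    Closed G S ↔ ∀ x ∉ S, ∀ y ∈ S, ∀ z ∈ S, G.Adj x y → G.Adj x z → y = z := by
  have h : ∀ x, (G.neighborSet x ∩ S).encard < 2 ↔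
      ∀ y ∈ S, ∀ z ∈ S, G.Adj x y → G.Adj x z → y = z := fun x => by
    rw [show (2 : ℕ∞) = 1 + 1 by norm_num, ENat.lt_add_one_iff (by simp), Set.encard_le_one_iff]
    exact ⟨fun h y hy z hz hxy hxz => h y z ⟨hxy, hy⟩ ⟨hxz, hz⟩,
      fun h y z hy hz => h y hy.2 z hz.2 hy.1 hz.1⟩
  exact forall₂_congr fun x _ => h x

theorem closed_hull (A : Set V) : Closed G (hull G A) := by
  rw [closed_iff]
  intro x hx y hy z hz hxy hxz
  simp only [hull, Set.mem_sInter, not_forall] at hx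
  obtain ⟨K, hK, hxK⟩ := hx
  exact closed_iff.1 hK.1 x hxK y (hy K hK) z (hz K hK) hxy hxz

theorem hull_subset (hK : Closed G K) (hA : A ⊆ K) : hull G A ⊆ K :=
  Set.sInter_subset_of_mem ⟨hK, hA⟩

theorem closed_play (L : Set V) (x : V) : Closed G (play G L x) :=
  closed_hull _

theorem mem_play (L : Set V) (x : V) : x ∈ play G L x :=
  insert_subset_play G L x (Set.mem_insert x L)

theorem subset_play (L : Set V) (x : V) : L ⊆ play G L x :=
  (Set.subset_insert x L).trans (insert_subset_play G L x)

theorem play_subset (hK : Closed G K) (hL : L ⊆ K) (hx : x ∈ K) : play G L x ⊆ K :=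
  hull_subset hK (Set.insert_subset hx hL)

theorem closed_singleton (x : V) : Closed G {x} := by
  rw [closed_iff]
  rintro - - y rfl z rfl - -
  rfl

theorem play_empty (x : V) : play G ∅ x = {x} :=
  (play_subset (closed_singleton x) (Set.empty_subset _) rfl).antisymm
    (Set.singleton_subset_iff.2 (mem_play _ _))

/-- `x` is within distance two of a vertex of `L` other than itself. -/
def Near (G : SimpleGraph V) (L : Set V) (x : V) : Prop :=
  ∃ y, (y = x ∨ G.Adj x y) ∧ ∃ z ∈ L, G.Adj y z

/-- The moves of the game in which each selected vertex, except for the first one, has to be within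
distance two of the labeled vertices. -/
def Move (G : SimpleGraph V) (L : Set V) (x : V) : Prop :=
  x ∉ L ∧ (L = ∅ ∨ Near G L x)

/-- The vertices labeled by a move near `L` extend a connected set that contains the part of `L` at
the boundary. -/
theorem connected_union_play [Finite V] (hK : (G.induce K).Connected)
    (hb : ∀ u ∈ L, ∀ w ∉ L, G.Adj u w → u ∈ K) (hxL : x ∉ L) (hx : Near G L x) :
    (G.induce (K ∪ play G L x \ L)).Connected := by
  -- A maximal member of this family is closed, since a vertex with two neighbours in it could still
  -- be attached; so it is the whole hull.
  let F : Set (Set V) := {S | insert x L ⊆ S ∧ S ⊆ play G L x ∧ (G.induce (K ∪ S \ L)).Connected}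
  have hins : ∀ S w, w ∉ L → K ∪ insert w S \ L = insert w (K ∪ S \ L) := by
    intro S w hw
    rw [Set.insert_sdiff_of_notMem _ hw, Set.union_insert]
  have hF : F.Nonempty := by
    have hone : ∀ y z, y ∉ L → z ∈ L → G.Adj y z → (G.induce (K ∪ insert y L \ L)).Connected := by
      intro y z hy hz hyz
      rw [hins _ _ hy, Set.sdiff_self, Set.union_empty]
      exact connected_induce_insert hK (hb z hz y hy hyz.symm) hyz.symm
    obtain ⟨y, hyx, z, hz, hyz⟩ := hx
    by_cases hyL : y ∈ L
    · have hxy : G.Adj x y := hyx.resolve_left (by rintro rfl; exact hxL hyL)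
      exact ⟨_, subset_rfl, insert_subset_play G L x, hone x y hxL hyL hxy⟩
    · have h1 := hone y z hyL hz hyz
      rcases hyx with rfl | hxy
      · exact ⟨_, subset_rfl, insert_subset_play G L y, h1⟩
      -- At distance two the middle vertex `y` starts the growth along with `x`: it has the two
      -- neighbours `x` and `z` in the hull.
      · refine ⟨insert x (insert y L), Set.insert_subset_insert (Set.subset_insert _ _),
          Set.insert_subset (mem_play _ _) (Set.insert_subset ?_ (subset_play _ _)), ?_⟩
        · by_contra hy
          have := closed_iff.1 (closed_play L x) y hy x (mem_play _ _) z (subset_play _ _ hz)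
            hxy.symm hyz
          exact hxL (this ▸ hz)
        · rw [hins _ _ hxL]
          exact connected_induce_insert h1 (.inr ⟨Set.mem_insert _ _, hyL⟩) hxy.symm
  obtain ⟨S, ⟨h1, h2, h3⟩, hmax⟩ := F.toFinite.exists_maximal hF
  have hS : Closed G S := by
    rw [closed_iff]
    intro w hw y hy z hz hwy hwz
    by_contra hyz
    have hwp : w ∈ play G L x := by
      by_contra hwp
      exact hyz (closed_iff.1 (closed_play L x) w hwp y (h2 hy) z (h2 hz) hwy hwz)
    have hwL : w ∉ L := fun h => hw (h1 (.inr h))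
    have hyK : y ∈ K ∪ S \ L := by
      by_cases hyL : y ∈ L
      · exact .inl (hb y hyL w hwL hwy.symm)
      · exact .inr ⟨hy, hyL⟩
    refine hw (hmax (y := insert w S) ⟨h1.trans (Set.subset_insert _ _), Set.insert_subset hwp h2, ?_⟩
      (Set.subset_insert _ _) (Set.mem_insert _ _))
    rw [hins _ _ hwL]
    exact connected_induce_insert h3 hyK hwy.symm
  have : S = play G L x := h2.antisymm (hull_subset hS h1)
  rwa [← this]

theorem legal_empty (x : V) : Legal G ∅ x := by
  refine ⟨Set.notMem_empty x, ?_⟩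
  rw [play_empty]
  exact connected_induce_singleton x

/-- If `x` is not near `L`, no vertex has neighbours both in `L` and equal to `x`, so `insert x L`
is already closed and `x` is isolated in it. The converse is `connected_union_play` with `K = L`. -/
theorem legal_iff [Finite V] (hL : Closed G L) (hc : L.Nonempty → (G.induce L).Connected) :
    Legal G L x ↔ Move G L x := by
  rcases L.eq_empty_or_nonempty with rfl | hne
  · exact iff_of_true (legal_empty x) ⟨Set.notMem_empty x, .inl rfl⟩
  have hc := hc hne
  have hun : L ∪ play G L x \ L = play G L x := Set.union_sdiff_cancel (subset_play _ _)
  refine ⟨fun h => ⟨h.1, .inr ?_⟩, fun h => ⟨h.1, ?_⟩⟩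
  · by_contra hx
    have hcl : Closed G (insert x L) := by
      rw [closed_iff]
      intro w hw y hy z hz hwy hwz
      have hwL : w ∉ L := fun h => hw (.inr h)
      rcases hy with rfl | hy <;> rcases hz with rfl | hz
      · rfl
      · exact absurd ⟨w, .inr hwy.symm, z, hz, hwz⟩ hx
      · exact absurd ⟨w, .inr hwz.symm, y, hy, hwy⟩ hx
      · exact closed_iff.1 hL w hwL y hy z hz hwy hwz
    have hsub : play G L x ⊆ insert x L := hull_subset hcl subset_rfl
    obtain ⟨z, hz⟩ := hne
    obtain ⟨u, -, w, hw, rfl, hwx, huw⟩ := exists_adj_of_connected_induce (X := {x}) h.2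
      (mem_play L x) (subset_play L x hz) rfl (by rintro rfl; exact h.1 hz)
    exact hx ⟨u, .inl rfl, w, (hsub hw).resolve_left hwx, huw⟩
  · rw [← hun]
    exact connected_union_play hc (fun u hu _ _ _ => hu) h.1 (h.2.resolve_left hne.ne_empty)

end Hull

/-! ### Grundy values -/

section Grundy

variable {V : Type*} [Finite V] {G : SimpleGraph V} {L : Set V}

theorem ncard_compl_play_lt_of_notMem {x : V} (hx : x ∉ L) :
    (play G L x)ᶜ.ncard < Lᶜ.ncard :=
  Set.ncard_lt_ncard ⟨Set.compl_subset_compl.2 (subset_play L x), fun h => h hx (mem_play L x)⟩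
    (Set.toFinite _)

theorem grundy_isMex (L : Set V) :
    IsMex {m | ∃ x, Legal G L x ∧ grundy G (play G L x) = m} (grundy G L) := by
  rw [grundy]
  convert IsMex.sInf_compl _ using 2
  · ext m
    simp
  · exact (Set.finite_range fun x => grundy G (play G L x)).subset
      fun m ⟨x, _, h⟩ => ⟨x, h⟩

/-- The Grundy value of the position `L` in the game with the moves `Move`. -/
noncomputable def value {V : Type*} [Finite V] (G : SimpleGraph V) (L : Set V) : ℕ :=
  sInf {m : ℕ | ∀ (x : V) (_ : Move G L x), value G (play G L x) ≠ m}
termination_by Lᶜ.ncard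
decreasing_by exact ncard_compl_play_lt_of_notMem (And.left ‹Move G L x›)

theorem value_isMex (L : Set V) :
    IsMex {m | ∃ x, Move G L x ∧ value G (play G L x) = m} (value G L) := by
  rw [value]
  convert IsMex.sInf_compl _ using 2
  · ext m
    simp
  · exact (Set.finite_range fun x => value G (play G L x)).subset
      fun m ⟨x, _, h⟩ => ⟨x, h⟩

/-- Each move labels at least one more vertex. The bound allows values to serve as array indices and
the search for the minimal excludant to stop at `n`. -/
theorem value_le (L : Set V) : value G L ≤ Lᶜ.ncard := by
  induction h : Lᶜ.ncard using Nat.strong_induction_on generalizing L with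
  | _ k ih =>
    subst h
    refine (value_isMex L).le ?_
    rintro ⟨x, hx, h⟩
    have h1 := ncard_compl_play_lt_of_notMem (G := G) hx.1
    have h2 := ih _ h1 _ rfl
    omega

/-- A legal move leads to a closed connected set again, so `legal_iff` applies throughout the play.
-/
theorem grundy_eq_value (hL : Closed G L) (hc : L.Nonempty → (G.induce L).Connected) :
    grundy G L = value G L := by
  induction h : Lᶜ.ncard using Nat.strong_induction_on generalizing L with
  | _ k ih =>
    subst h
    refine (grundy_isMex L).unique ?_
    convert value_isMex (G := G) L using 1
    ext m
    refine exists_congr fun x => ?_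
    rw [← legal_iff hL hc]
    refine and_congr_right fun hx => ?_
    rw [ih _ (ncard_compl_play_lt G hx) (closed_play L x) (fun _ => hx.2) rfl]

theorem moverWins_iff (L : Set V) : MoverWins G L ↔ grundy G L ≠ 0 := by
  induction h : Lᶜ.ncard using Nat.strong_induction_on generalizing L with
  | _ k ih =>
    subst h
    constructor
    · rintro ⟨x, hx, h⟩ h0
      have hm := (grundy_isMex (G := G) L).1
      rw [h0] at hm
      obtain ⟨y, hy, hy0⟩ := (grundy_isMex (play G L x)).2 0
        (Nat.pos_of_ne_zero fun h => hm ⟨x, hx, h⟩)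
      exact (ih _ ((ncard_compl_play_lt G hy).trans (ncard_compl_play_lt G hx)) _ rfl).1 (h y hy) hy0
    · intro h0
      obtain ⟨x, hx, hx0⟩ := (grundy_isMex (G := G) L).2 0 (Nat.pos_of_ne_zero h0)
      refine ⟨x, hx, fun y hy => ?_⟩
      refine (ih _ ((ncard_compl_play_lt G hy).trans (ncard_compl_play_lt G hx)) _ rfl).2
        fun h => (grundy_isMex (G := G) (play G L x)).1 ?_
      rw [hx0]
      exact ⟨y, hy, h⟩

theorem playerOneWins_iff : PlayerOneWins G ↔ grundy G ∅ ≠ 0 :=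
  moverWins_iff ∅

theorem playerTwoWins_iff : PlayerTwoWins G ↔ grundy G ∅ = 0 := by
  constructor
  · intro h
    by_contra h0
    obtain ⟨x, hx, hx0⟩ := (grundy_isMex (G := G) ∅).2 0 (Nat.pos_of_ne_zero h0)
    exact (moverWins_iff _).1 (h x hx) hx0
  · intro h x hx
    refine (moverWins_iff _).2 fun h0 => (grundy_isMex (G := G) ∅).1 ?_
    rw [h]
    exact ⟨x, hx, h0⟩

end Grundy

/-! ### The decomposition of a position -/

section Decomposition

variable {V : Type*} {G : SimpleGraph V} {L A B : Set V}

/-- A move in `A` does not spread into `B`: the neighbours of a vertex of `B` that get labeled were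
labeled before, and by closedness there is at most one of them. Conversely, labeling `B` in advance
does not help inside `A`, which has no edges to `B`. -/
theorem play_compl_union (hB : Closed G (A ∪ B)ᶜ)
    (hAB : ∀ a ∈ A, ∀ b ∈ B, ¬ G.Adj a b) (hd : Disjoint A B) {x : V} (hx : x ∈ A) :
    play G (A ∪ B)ᶜ x = ((play G Aᶜ x)ᶜ ∪ B)ᶜ := by
  have h1 : ((play G Aᶜ x)ᶜ ∪ B)ᶜ = play G Aᶜ x \ B := by
    rw [Set.compl_union, compl_compl]; rfl
  rw [h1]
  apply Set.Subset.antisymm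
  · refine play_subset (closed_iff.2 ?_) ?_ ⟨mem_play _ _, Set.disjoint_left.1 hd hx⟩
    · intro w hw y hy z hz hwy hwz
      by_cases hwp : w ∈ play G Aᶜ x
      · have hwB : w ∈ B := by
          by_contra hwB
          exact hw ⟨hwp, hwB⟩
        have hL : ∀ u ∈ play G Aᶜ x \ B, G.Adj w u → u ∈ (A ∪ B)ᶜ := by
          rintro u hu hwu (h | h)
          exacts [hAB u h w hwB hwu.symm, hu.2 h]
        exact closed_iff.1 hB w (fun h => h (.inr hwB)) y (hL y hy hwy) z (hL z hz hwz) hwy hwz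
      · exact closed_iff.1 (closed_play _ _) w hwp y hy.1 z hz.1 hwy hwz
    · exact fun w hw => ⟨subset_play _ _ fun h => hw (.inl h), fun h => hw (.inr h)⟩
  · rintro w ⟨hw, hwB⟩
    have hcl : Closed G (play G (A ∪ B)ᶜ x ∪ B) := by
      rw [closed_iff]
      intro w hw y hy z hz hwy hwz
      have hwA : w ∈ A := by
        by_contra hwA
        exact hw (.inl (subset_play _ _ fun h => h.elim hwA fun h => hw (.inr h)))
      have hp : ∀ u ∈ play G (A ∪ B)ᶜ x ∪ B, G.Adj w u → u ∈ play G (A ∪ B)ᶜ x :=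
        fun u hu hwu => hu.resolve_right fun h => hAB w hwA u h hwu
      exact closed_iff.1 (closed_play _ _) w (fun h => hw (.inl h)) y (hp y hy hwy) z (hp z hz hwz)
        hwy hwz
    refine (play_subset hcl ?_ (.inl (mem_play _ _)) hw).resolve_right hwB
    intro u hu
    by_cases huB : u ∈ B
    · exact .inr huB
    · exact .inl (subset_play _ _ fun h => h.elim hu huB)

/-- A path of length two from `x` in `A` to a vertex of `B` has its middle vertex outside both
parts, hence labeled, so `x` is near anyway. -/
theorem near_compl_union (hAB : ∀ a ∈ A, ∀ b ∈ B, ¬ G.Adj a b) {x : V}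
    (hx : x ∈ A) : Near G (A ∪ B)ᶜ x ↔ Near G Aᶜ x := by
  constructor
  · rintro ⟨y, hy, z, hz, hyz⟩
    exact ⟨y, hy, z, fun h => hz (.inl h), hyz⟩
  · rintro ⟨y, hy, z, hz, hyz⟩
    by_cases hzB : z ∈ B
    · have hyA : y ∉ A := fun h => hAB y h z hzB hyz
      have hxy : G.Adj x y := hy.resolve_left (by rintro rfl; exact hyA hx)
      exact ⟨x, .inl rfl, y, fun h => h.elim hyA fun h => hAB x hx y h hxy, hxy⟩
    · exact ⟨y, hy, z, fun h => h.elim hz hzB, hyz⟩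

/-- Nonemptiness excludes the first move of the game, which is exempt from the distance condition
and would couple the two parts. -/
theorem move_compl_union (hne : (A ∪ B)ᶜ.Nonempty)
    (hAB : ∀ a ∈ A, ∀ b ∈ B, ¬ G.Adj a b) {x : V} (hx : x ∈ A) :
    Move G (A ∪ B)ᶜ x ↔ Move G Aᶜ x := by
  have hne' : Aᶜ.Nonempty := hne.mono (Set.compl_subset_compl.2 Set.subset_union_left)
  rw [Move, Move, near_compl_union hAB hx]
  simp only [hne'.ne_empty, hne.ne_empty, false_or]
  exact and_congr_left fun _ => iff_of_true (fun h => h (.inl hx)) fun h => h hx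

/-- A position whose unlabeled vertices fall apart into two parts is a sum. -/
theorem value_compl_union [Finite V] (hL : Closed G (A ∪ B)ᶜ) (hne : (A ∪ B)ᶜ.Nonempty)
    (hAB : ∀ a ∈ A, ∀ b ∈ B, ¬ G.Adj a b) (hd : Disjoint A B) :
    value G (A ∪ B)ᶜ = value G Aᶜ ^^^ value G Bᶜ := by
  induction h : (A ∪ B).ncard using Nat.strong_induction_on generalizing A B with
  | _ k ih =>
    subst h
    have hBA : ∀ b ∈ B, ∀ a ∈ A, ¬ G.Adj b a := fun b hb a ha h => hAB a ha b hb h.symm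
    -- A move in `A` leads to a position of the same form with a smaller `A`, to which the induction
    -- hypothesis applies.
    have hl : ∀ x ∈ A, value G (play G (A ∪ B)ᶜ x) = value G (play G Aᶜ x) ^^^ value G Bᶜ := by
      intro x hx
      have hp := play_compl_union hL hAB hd hx
      have hs : (play G Aᶜ x)ᶜ ⊆ A := Set.compl_subset_comm.1 (subset_play _ _)
      have := ih ((play G Aᶜ x)ᶜ ∪ B).ncard (Set.ncard_lt_ncard ⟨Set.union_subset_union_left _ hs,
        fun h => (h (.inl hx)).elim (fun h => h (mem_play _ _)) (Set.disjoint_left.1 hd hx)⟩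
          (Set.toFinite _)) (hp ▸ closed_play _ _) (hp ▸ ⟨x, mem_play _ _⟩)
        (fun a ha => hAB a (hs ha)) (hd.mono_left hs) rfl
      rw [hp, this, compl_compl]
    have hr : ∀ x ∈ B, value G (play G (A ∪ B)ᶜ x) = value G Aᶜ ^^^ value G (play G Bᶜ x) := by
      intro x hx
      have hp := play_compl_union (A := B) (B := A) (by rwa [Set.union_comm]) hBA hd.symm hx
      have hs : (play G Bᶜ x)ᶜ ⊆ B := Set.compl_subset_comm.1 (subset_play _ _)
      rw [Set.union_comm B A, Set.union_comm _ A] at hp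
      have := ih (A ∪ (play G Bᶜ x)ᶜ).ncard (Set.ncard_lt_ncard ⟨Set.union_subset_union_right _ hs,
        fun h => (h (.inr hx)).elim (Set.disjoint_right.1 hd hx) (fun h => h (mem_play _ _))⟩
          (Set.toFinite _)) (hp ▸ closed_play _ _) (hp ▸ ⟨x, mem_play _ _⟩)
        (fun a ha b hb => hAB a ha b (hs hb)) (hd.mono_right hs) rfl
      rw [hp, this, compl_compl]
    refine (value_isMex _).unique ?_
    convert (value_isMex (G := G) Aᶜ).xor (value_isMex (G := G) Bᶜ) using 1
    have hml := fun x (hx : x ∈ A) => move_compl_union hne hAB hx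
    have hmr := fun x (hx : x ∈ B) => move_compl_union (A := B) (B := A)
      (by rwa [Set.union_comm]) hBA hx
    rw [Set.union_comm B A] at hmr
    ext k
    constructor
    · rintro ⟨x, hx, rfl⟩
      rcases not_not.1 hx.1 with hxA | hxB
      · exact .inl ⟨_, ⟨x, (hml x hxA).1 hx, rfl⟩, (hl x hxA).symm⟩
      · exact .inr ⟨_, ⟨x, (hmr x hxB).1 hx, rfl⟩, (hr x hxB).symm⟩
    · rintro (⟨_, ⟨x, hx, rfl⟩, rfl⟩ | ⟨_, ⟨x, hx, rfl⟩, rfl⟩)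
      · exact ⟨x, (hml x (not_not.1 hx.1)).2 hx, hl x (not_not.1 hx.1)⟩
      · exact ⟨x, (hmr x (not_not.1 hx.1)).2 hx, hr x (not_not.1 hx.1)⟩

theorem value_univ [Finite V] : value G Set.univ = 0 :=
  Nat.le_zero.1 ((value_le _).trans (by simp))

/-! ### Components of the unlabeled part -/

/-- The vertices that can be reached from `v` without entering `L`. -/
def reach (G : SimpleGraph V) (L : Set V) (v : V) : Set V :=
  {w | Relation.ReflTransGen (fun a b => G.Adj a b ∧ b ∉ L) v w}

theorem self_mem_reach (L : Set V) (v : V) : v ∈ reach G L v :=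
  Relation.ReflTransGen.refl

theorem reach_step {v a b : V} (ha : a ∈ reach G L v) (hab : G.Adj a b) (hb : b ∉ L) :
    b ∈ reach G L v :=
  Relation.ReflTransGen.tail ha ⟨hab, hb⟩

theorem notMem_of_mem_reach {v w : V} (hv : v ∉ L) (hw : w ∈ reach G L v) : w ∉ L := by
  induction hw with
  | refl => exact hv
  | tail _ h => exact h.2

theorem mem_reach_trans {v w u : V} (hw : w ∈ reach G L v) (hu : u ∈ reach G L w) :
    u ∈ reach G L v :=
  Relation.ReflTransGen.trans hw hu

theorem mem_reach_symm {v w : V} (hv : v ∉ L) (hw : w ∈ reach G L v) : v ∈ reach G L w := by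
  induction hw with
  | refl => exact self_mem_reach _ _
  | tail hab h ih =>
    exact Relation.ReflTransGen.head ⟨h.1.symm, notMem_of_mem_reach hv hab⟩ ih

theorem reach_anti {L L' : Set V} (h : L ⊆ L') (v : V) : reach G L' v ⊆ reach G L v :=
  fun _ hw => Relation.ReflTransGen.mono (fun _ _ hab => ⟨hab.1, fun hb => hab.2 (h hb)⟩) _ _ hw

theorem connected_induce_reach [Finite V] (v : V) : (G.induce (reach G L v)).Connected := by
  let F : Set (Set V) := {S | v ∈ S ∧ S ⊆ reach G L v ∧ (G.induce S).Connected}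
  obtain ⟨S, ⟨h1, h2, h3⟩, hmax⟩ := F.toFinite.exists_maximal ⟨{v}, rfl,
    Set.singleton_subset_iff.2 (self_mem_reach _ _), connected_induce_singleton _⟩
  have : S = reach G L v := by
    refine h2.antisymm fun w hw => ?_
    induction hw with
    | refl => exact h1
    | tail hab h ih =>
      exact hmax ⟨.inr h1, Set.insert_subset (reach_step hab h.1 h.2) h2,
        connected_induce_insert h3 ih h.1⟩ (Set.subset_insert _ _) (Set.mem_insert _ _)
  rwa [← this]

theorem closed_compl (hL : Closed G L) (hA : A ⊆ Lᶜ)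
    (h : ∀ a ∈ A, ∀ b ∉ A, G.Adj a b → b ∈ L) : Closed G Aᶜ := by
  rw [closed_iff] at hL ⊢
  intro x hx y hy z hz hxy hxz
  have hx := not_not.1 hx
  exact hL x (hA hx) y (h x hx y hy hxy) z (h x hx z hz hxz) hxy hxz

variable {n : ℕ} {H : SimpleGraph (Fin n)} {M : Set (Fin n)}

/-- The union of the components of the unlabeled part that contain a vertex below `k`. -/
def reachBelow (H : SimpleGraph (Fin n)) (M : Set (Fin n)) (k : ℕ) : Set (Fin n) :=
  {w | ∃ i : Fin n, i.val < k ∧ i ∉ M ∧ w ∈ reach H M i}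

/-- `v` is the least vertex of its component. -/
def IsLeast (H : SimpleGraph (Fin n)) (M : Set (Fin n)) (v : Fin n) : Prop :=
  v ∉ M ∧ ∀ w < v, w ∉ reach H M v

theorem reachBelow_subset (k : ℕ) : reachBelow H M k ⊆ Mᶜ :=
  fun _ ⟨_, _, hi, hw⟩ => notMem_of_mem_reach hi hw

theorem mem_of_adj_reachBelow {k : ℕ} {a b : Fin n} (ha : a ∈ reachBelow H M k)
    (hb : b ∉ reachBelow H M k) (hab : H.Adj a b) : b ∈ M := by
  by_contra hbM
  obtain ⟨i, hi, hiM, hw⟩ := ha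
  exact hb ⟨i, hi, hiM, reach_step hw hab hbM⟩

theorem reachBelow_size : reachBelow H M n = Mᶜ :=
  (reachBelow_subset n).antisymm fun w hw => ⟨w, w.2, hw, self_mem_reach _ _⟩

/-- Either `v` is labeled or its component already contains a smaller vertex, through which it has
been counted. -/
theorem reachBelow_succ_of_not (v : Fin n) (hv : ¬ IsLeast H M v) :
    reachBelow H M (v + 1) = reachBelow H M v := by
  ext w
  constructor
  · rintro ⟨i, hi, hiM, hw⟩
    rcases Nat.lt_succ_iff_lt_or_eq.1 hi with hi | hi
    · exact ⟨i, hi, hiM, hw⟩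
    · obtain rfl : i = v := Fin.ext hi
      obtain ⟨u, hu, hur⟩ : ∃ u < i, u ∈ reach H M i := by
        by_contra! h
        exact hv ⟨hiM, h⟩
      exact ⟨u, hu, notMem_of_mem_reach hiM hur, mem_reach_trans (mem_reach_symm hiM hur) hw⟩
  · rintro ⟨i, hi, h⟩
    exact ⟨i, hi.trans (Nat.lt_succ_self _), h⟩

theorem reachBelow_succ (v : Fin n) (hv : v ∉ M) :
    reachBelow H M (v + 1) = reachBelow H M v ∪ reach H M v := by
  ext w
  constructor
  · rintro ⟨i, hi, hiM, hw⟩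
    rcases Nat.lt_succ_iff_lt_or_eq.1 hi with hi | hi
    · exact .inl ⟨i, hi, hiM, hw⟩
    · obtain rfl : i = v := Fin.ext hi
      exact .inr hw
  · rintro (⟨i, hi, h⟩ | h)
    · exact ⟨i, hi.trans (Nat.lt_succ_self _), h⟩
    · exact ⟨v, Nat.lt_succ_self _, hv, h⟩

theorem disjoint_reachBelow (v : Fin n) (hv : IsLeast H M v) :
    Disjoint (reachBelow H M v) (reach H M v) := by
  rw [Set.disjoint_left]
  rintro w ⟨i, hi, hiM, hw⟩ hwv
  exact hv.2 i hi (mem_reach_trans hwv (mem_reach_symm hiM hw))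

theorem value_reachBelow_succ (hM : Closed H M) (hne : M.Nonempty) (v : Fin n)
    (hv : IsLeast H M v) : value H (reachBelow H M (v + 1))ᶜ =
      value H (reachBelow H M v)ᶜ ^^^ value H (reach H M v)ᶜ := by
  rw [reachBelow_succ v hv.1]
  refine value_compl_union ?_ ?_ ?_ (disjoint_reachBelow v hv)
  · rw [← reachBelow_succ v hv.1]
    exact closed_compl hM (reachBelow_subset _) fun a ha b hb => mem_of_adj_reachBelow ha hb
  · rw [← reachBelow_succ v hv.1]
    exact hne.mono (Set.subset_compl_comm.1 (reachBelow_subset _))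
  · intro a ha b hb hab
    have hb' : b ∉ reachBelow H M v := fun h =>
      Set.disjoint_left.1 (disjoint_reachBelow v hv) h hb
    exact notMem_of_mem_reach hv.1 hb (mem_of_adj_reachBelow ha hb' hab)

/-! ### Positions in a cactus -/

/-- Closed sets whose boundary is contained in a connected subset. -/
def Solid (G : SimpleGraph V) (L : Set V) : Prop :=
  Closed G L ∧ ∃ K ⊆ L, (G.induce K).Connected ∧ ∀ u ∈ L, ∀ w ∉ L, G.Adj u w → u ∈ K

theorem Solid.nonempty (h : Solid G L) : L.Nonempty := by
  obtain ⟨-, K, hKL, hK, -⟩ := h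
  obtain ⟨x, hx⟩ := hK.nonempty
  exact ⟨x, hKL hx⟩

theorem solid_singleton (x : V) : Solid G {x} :=
  ⟨closed_singleton x, {x}, subset_rfl, connected_induce_singleton x, fun _ hu _ _ _ => hu⟩

/-- This is why `Solid` replaces connectedness: the complement of a component may be disconnected,
as `G` may be, but its boundary lies in that of `L`, so the same `K` serves. -/
theorem Solid.compl_reach (h : Solid G L) {v : V} (hv : v ∉ L) : Solid G (reach G L v)ᶜ := by
  obtain ⟨hL, K, hKL, hK, hb⟩ := h
  have hr : reach G L v ⊆ Lᶜ := fun w => notMem_of_mem_reach hv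
  have hadj : ∀ a ∈ reach G L v, ∀ b ∉ reach G L v, G.Adj a b → b ∈ L := fun a ha b hb hab => by
    by_contra hbL
    exact hb (reach_step ha hab hbL)
  refine ⟨closed_compl hL hr hadj, K, hKL.trans (Set.subset_compl_comm.1 hr), hK, ?_⟩
  intro u hu w hw huw
  have hw := not_not.1 hw
  exact hb u (hadj w hw u hu huw.symm) w (hr hw) huw

theorem Solid.play [Finite V] (h : L = ∅ ∨ Solid G L) {x : V} (hx : Move G L x) :
    Solid G (play G L x) := by
  rcases h with rfl | h
  · rw [play_empty]
    exact solid_singleton x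
  have hne := h.nonempty
  obtain ⟨hL, K, hKL, hK, hb⟩ := h
  refine ⟨closed_play L x, _, Set.union_subset (hKL.trans (subset_play L x)) Set.sdiff_subset,
    connected_union_play hK hb hx.1 (hx.2.resolve_left hne.ne_empty), fun u hu w hw huw => ?_⟩
  by_cases huL : u ∈ L
  · exact .inl (hb u huL w (fun h => hw (subset_play L x h)) huw)
  · exact .inr ⟨hu, huL⟩

/-- In a cactus, a component of the unlabeled part has at most two labeled neighbours. -/
theorem Solid.exists_pair [Finite V] (hG : IsCactus G) (h : Solid G L) {v : V} (hv : v ∉ L) :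
    ∃ u₁ ∈ L, ∃ u₂ ∈ L, ∀ u ∈ L, ∀ w ∈ reach G L v, G.Adj w u → u = u₁ ∨ u = u₂ := by
  obtain ⟨u₀, hu₀⟩ := h.nonempty
  obtain ⟨hL, K, hKL, hK, hb⟩ := h
  by_contra! hcon
  -- The negation, applied to pairs found so far, yields three distinct labeled neighbours; `u₀`
  -- only fills the pair at the start.
  obtain ⟨a, ha, wa, hwa, haw, -⟩ := hcon u₀ hu₀ u₀ hu₀
  obtain ⟨b, hbL, wb, hwb, hbw, hba, -⟩ := hcon a ha a ha
  obtain ⟨c, hc, wc, hwc, hcw, hca, hcb⟩ := hcon a ha b hbL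
  have hr : ∀ w ∈ reach G L v, w ∉ L := fun w => notMem_of_mem_reach hv
  -- An unlabeled vertex has at most one labeled neighbour, so distinct labeled neighbours attach at
  -- distinct vertices.
  have hne : ∀ {x y wx wy}, x ∈ L → y ∈ L → wx ∈ reach G L v → G.Adj wx x → G.Adj wy y → x ≠ y →
      wx ≠ wy := by
    rintro x y w _ hx hy hw hwx hwy hxy rfl
    exact hxy (closed_iff.1 hL w (hr w hw) x hx y hy hwx hwy)
  have hab := hne ha hbL hwa haw hbw hba.symm
  have hac := hne ha hc hwa haw hcw hca.symm
  have hbc := hne hbL hc hwb hbw hcw hcb.symm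
  refine hG (isGraphMinor_diamond (v := ![wa, wb, wc]) hK (connected_induce_reach (L := L) v) ?_ ?_
    ?_ ?_)
  · exact Set.disjoint_left.2 fun x hx hxr => hr x hxr (hKL hx)
  · intro i j
    fin_cases i <;> fin_cases j <;> simp [hab, hac, hbc, hab.symm, hac.symm, hbc.symm]
  · intro i
    fin_cases i
    exacts [hwa, hwb, hwc]
  · intro i
    fin_cases i
    exacts [⟨a, hb a ha wa (hr _ hwa) haw.symm, haw.symm⟩,
      ⟨b, hb b hbL wb (hr _ hwb) hbw.symm, hbw.symm⟩, ⟨c, hb c hc wc (hr _ hwc) hcw.symm, hcw.symm⟩]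

/-- A walk that avoids `u₁` and `u₂` can leave the component only through another labeled neighbour,
and there is none. So the component is recovered from three vertices, without knowledge of `L`. -/
theorem reach_pair {v u₁ u₂ : V} (h₁ : u₁ ∈ L) (h₂ : u₂ ∈ L)
    (h : ∀ u ∈ L, ∀ w ∈ reach G L v, G.Adj w u → u = u₁ ∨ u = u₂) :
    reach G {u₁, u₂} v = reach G L v := by
  refine Set.Subset.antisymm (fun w hw => ?_)
    (reach_anti (Set.insert_subset h₁ (Set.singleton_subset_iff.2 h₂)) v)
  induction hw with
  | refl => exact self_mem_reach _ _
  | tail _ hab ih => exact reach_step ih hab.1 fun hb => hab.2 (h _ hb _ ih hab.1)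

end Decomposition

end P3Game

/-! ### The algorithm -/

namespace RAM

/-- Access to an array, with the value `0` for indices out of range. -/
def Env.cell (a : ℕ) (F G H : Env → ℕ) (e : Env) : ℕ :=
  if F e < e.n ∧ G e < e.n ∧ H e < e.n then e.arr a (F e) (G e) (H e) else 0

/-- The vertices in the variables `i` and `j` are adjacent. -/
def Env.Adj (i j : ℕ) (e : Env) : Prop :=
  e.adj (e.var i) (e.var j) = 1

/-- The vertex in the variable `i` belongs to the set in the array `a`. -/
def Env.Mem (a i : ℕ) (e : Env) : Prop :=
  Env.cell a (fun e => e.var i) (fun e => e.var i) (fun e => e.var i) e = 1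

/-- The vertices in the variables `i` and `j` are related by the relation in the array `a`. -/
def Env.Rel (a i j : ℕ) (e : Env) : Prop :=
  Env.cell a (fun e => e.var i) (fun e => e.var i) (fun e => e.var j) e = 1

theorem CompPred.adj (i j : ℕ) : CompPred (Env.Adj i j) :=
  .eq (Comp.adj (.var i) (.var j)) (.const 1)

theorem CompPred.mem (a i : ℕ) : CompPred (Env.Mem a i) :=
  .eq (Comp.arr a (.var i) (.var i) (.var i)) (.const 1)

theorem CompPred.rel (a i j : ℕ) : CompPred (Env.Rel a i j) :=
  .eq (Comp.arr a (.var i) (.var i) (.var j)) (.const 1)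

theorem CompPred.varEq (i j : ℕ) : CompPred fun e => e.var i = e.var j :=
  .eq (.var i) (.var j)

/-- An iteration whose step ignores the current array, which the shift `(· + 1)` hides; after zero
rounds the initial array is the same. -/
theorem Comp.letArr {I B : Env → ℕ} (hI : Comp I) (hB : Comp B) :
    Comp fun e => B (e.pushArr fun x y z => I (((e.push x).push y).push z)) := by
  have h := Comp.iterArr hI (hI.rename id (· + 1)) hB
  convert h using 3 with e
  cases e.n <;> rfl

open Classical in
/-- The least `m < n` for which `Q` does not hold, and `n` if there is none. -/
noncomputable def Env.mex (Q : Env → Prop) (e : Env) : ℕ :=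
  e.iter (fun _ => 0) (fun e => if e.var 0 = e.var 1 ∧
    Q { e with var := fun i => e.var (i + 1), arr := fun a => e.arr (id a) } then
      e.var 1 + 1 else e.var 0) e.n

theorem Comp.mex {Q : Env → Prop} (hQ : CompPred Q) : Comp (Env.mex Q) := by
  classical
  exact Comp.iter (.const 0) (Comp.cond
    ((CompPred.varEq 0 1).and (Comp.rename hQ (· + 1) id : CompPred _))
    ((Comp.var 1).add (.const 1)) (.var 0))

/-- After `k` rounds the accumulator is `min m k`: it advances only while it equals the counter and
`Q` holds. -/
theorem Env.mex_eq {Q : Env → Prop} {e : Env} {m : ℕ} (h : IsMex {k | Q (e.push k)} m)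
    (hm : m ≤ e.n) : e.mex Q = m := by
  classical
  have key : ∀ k, e.iter (fun _ => 0) (fun e => if e.var 0 = e.var 1 ∧
    Q { e with var := fun i => e.var (i + 1), arr := fun a => e.arr (id a) } then
      e.var 1 + 1 else e.var 0) k = min m k := by
    intro k
    induction k with
    | zero => simp [iter]
    | succ k ih =>
      have hs : ∀ x, x = min m k → (if x = k ∧ Q (e.push k) then k + 1 else x) = min m (k + 1) := by
        rintro x rfl
        rcases lt_trichotomy k m with hk | rfl | hk
        · rw [if_pos ⟨min_eq_right hk.le, h.2 k hk⟩, min_eq_right hk]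
        · rw [if_neg fun hx => h.1 hx.2]
          simp
        · rw [if_neg fun hx => by omega]
          omega
      exact hs _ ih
  have := key e.n
  rw [min_eq_left hm] at this
  rw [← this, mex]

open Classical in
/-- The value of `F` for the last `i < n` for which `Q` holds. -/
noncomputable def Env.pick (Q : Env → Prop) (F : Env → ℕ) (e : Env) : ℕ :=
  e.iter (fun _ => 0) (fun e =>
    if Q { e with var := fun i => e.var (i + 1), arr := fun a => e.arr (id a) } then
      F { e with var := fun i => e.var (i + 1), arr := fun a => e.arr (id a) } else e.var 0) e.n

theorem Comp.pick {Q : Env → Prop} {F : Env → ℕ} (hQ : CompPred Q) (hF : Comp F) :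
    Comp (Env.pick Q F) := by
  classical
  exact Comp.iter (.const 0) (Comp.cond (Comp.rename hQ (· + 1) id : CompPred _)
    (hF.rename (· + 1) id) (.var 0))

theorem Env.pick_eq {Q : Env → Prop} {F : Env → ℕ} {e : Env} {c : ℕ}
    (h : ∃ i < e.n, Q (e.push i)) (hc : ∀ i < e.n, Q (e.push i) → F (e.push i) = c) :
    e.pick Q F = c := by
  classical
  have key : ∀ k ≤ e.n, (∃ i < k, Q (e.push i)) → e.iter (fun _ => 0) (fun e =>
    if Q { e with var := fun i => e.var (i + 1), arr := fun a => e.arr (id a) } then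
      F { e with var := fun i => e.var (i + 1), arr := fun a => e.arr (id a) } else e.var 0) k = c := by
    intro k
    induction k with
    | zero => simp
    | succ k ih =>
      rintro hk ⟨i, hi, hQ⟩
      have hs : ∀ x, ((∃ i < k, Q (e.push i)) → x = c) →
          (if Q (e.push k) then F (e.push k) else x) = c := by
        intro x hx
        split_ifs with hQk
        · exact hc k hk hQk
        · refine hx ⟨i, lt_of_le_of_ne (Nat.lt_succ_iff.1 hi) ?_, hQ⟩
          rintro rfl
          exact hQk hQ
      exact hs _ (ih (by omega))
  exact key e.n le_rfl h

theorem exists_lt_iff {n : ℕ} {p : ℕ → Prop} : (∃ i < n, p i) ↔ ∃ i : Fin n, p i :=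
  ⟨fun ⟨i, hi, h⟩ => ⟨⟨i, hi⟩, h⟩, fun ⟨i, h⟩ => ⟨i, i.2, h⟩⟩

theorem forall_lt_iff {n : ℕ} {p : ℕ → Prop} : (∀ i < n, p i) ↔ ∀ i : Fin n, p i :=
  ⟨fun h i => h i i.2, fun h i hi => h ⟨i, hi⟩⟩

/-! ### The table of the nim sums -/

/-- The array `0`, the table of the nim sums, holds the variable `0` for a pair that is obtained from
the variables `2` and `1` by decreasing one of them. -/
def NimExcluded (e : Env) : Prop :=
  (∃ i < e.n, i < e.var 2 ∧ Env.cell 0 (fun e => e.var 0) (fun e => e.var 0) (fun e => e.var 2)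
      (e.push i) = e.var 0) ∨
    ∃ j < e.n, j < e.var 1 ∧ Env.cell 0 (fun e => e.var 3) (fun e => e.var 3) (fun e => e.var 0)
      (e.push j) = e.var 0

theorem compPred_nimExcluded : CompPred NimExcluded := by
  refine .or ?_ ?_
  · exact (((CompPred.lt (.var 0) (.var 3)).and
      (.eq (Comp.arr 0 (.var 0) (.var 0) (.var 2)) (.var 1))).exists_lt)
  · exact (((CompPred.lt (.var 0) (.var 2)).and
      (.eq (Comp.arr 0 (.var 3) (.var 3) (.var 0)) (.var 1))).exists_lt)

/-- Two heaps of sizes `a` and `b`. This recursion computes nim sums without bit operations. -/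
theorem isMex_xor (a b : ℕ) :
    IsMex {k | (∃ i < a, i ^^^ b = k) ∨ ∃ j < b, a ^^^ j = k} (a ^^^ b) := by
  have h : ∀ c, IsMex {k | k < c} c := fun c => ⟨lt_irrefl c, fun _ h => h⟩
  exact (h a).xor (h b)

theorem xor_le_add (a b : ℕ) : a ^^^ b ≤ a + b := by
  induction h : a + b using Nat.strong_induction_on generalizing a b with
  | _ k ih =>
    subst h
    refine (isMex_xor a b).le ?_
    rintro (⟨i, hi, h⟩ | ⟨j, hj, h⟩)
    · have := ih (i + b) (by omega) i b rfl
      omega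
    · have := ih (a + j) (by omega) a j rfl
      omega

/-- The array holds the table of the nim sums. -/
def NimTable (n : ℕ) (A : ℕ → ℕ → ℕ → ℕ) : Prop :=
  ∀ x y z, y + z < n → A x y z = y ^^^ z

/-- After `t` rounds the entries with `y + z < t` are correct, since the recursion only decreases
the sum. -/
theorem nimTable_iterArr (e : Env) :
    NimTable e.n (e.iterArr (fun _ => 0) (Env.mex NimExcluded) e.n) := by
  have key : ∀ t ≤ e.n, ∀ x y z, y + z < t →
      e.iterArr (fun _ => 0) (Env.mex NimExcluded) t x y z = y ^^^ z := by
    intro t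
    induction t with
    | zero => intro _ x y z h; omega
    | succ t ih =>
      intro ht x y z h
      refine Env.mex_eq ?_ (show y ^^^ z ≤ e.n from (xor_le_add y z).trans (by omega))
      convert isMex_xor y z using 1
      ext k
      refine or_congr ⟨?_, ?_⟩ ⟨?_, ?_⟩
      · rintro ⟨i, hi, hiy, hk⟩
        have hi : i < e.n := hi
        have hiy : i < y := hiy
        refine ⟨i, hiy, ?_⟩
        rw [← ih (by omega) i i z (by omega)]
        rwa [Env.cell, if_pos ⟨hi, hi, show z < e.n by omega⟩] at hk
      · rintro ⟨i, hi, hk⟩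
        have hi' : i < e.n := by omega
        refine ⟨i, hi', hi, ?_⟩
        rw [Env.cell, if_pos ⟨hi', hi', show z < e.n by omega⟩]
        exact (ih (by omega) i i z (by omega)).trans hk
      · rintro ⟨j, hj, hjz, hk⟩
        have hj : j < e.n := hj
        have hjz : j < z := hjz
        refine ⟨j, hjz, ?_⟩
        have hy : y < e.n := by omega
        rw [← ih (by omega) y y j (by omega)]
        rwa [Env.cell, if_pos ⟨hy, hy, hj⟩] at hk
      · rintro ⟨j, hj, hk⟩
        have hj' : j < e.n := by omega
        have hy : y < e.n := by omega
        refine ⟨j, hj', hj, ?_⟩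
        rw [Env.cell, if_pos ⟨hy, hy, hj'⟩]
        exact (ih (by omega) y y j (by omega)).trans hk
  exact key e.n le_rfl

/-! ### Hulls and components by iteration -/

/-- Every round that changes the set adds an element, so `n` rounds reach a fixed point. -/
theorem iterate_fixed {n : ℕ} {f : Set (Fin n) → Set (Fin n)} (hf : ∀ S, S ⊆ f S)
    (S : Set (Fin n)) : f (f^[n] S) = f^[n] S := by
  have key : ∀ t, f (f^[t] S) = f^[t] S ∨ t ≤ (f^[t] S).ncard := by
    intro t
    induction t with
    | zero => exact .inr (Nat.zero_le _)
    | succ t ih =>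
      rw [Function.iterate_succ_apply']
      by_cases h : f (f^[t] S) = f^[t] S
      · exact .inl (by rw [h, h])
      · have h1 := ih.resolve_left h
        have h2 := Set.ncard_lt_ncard ((hf (f^[t] S)).ssubset_of_ne (Ne.symm h)) (Set.toFinite _)
        exact .inr (by omega)
  rcases key n with h | h
  · exact h
  · have hu : f^[n] S = Set.univ := by
      by_contra hne
      have := Set.ncard_lt_card hne
      rw [Nat.card_eq_fintype_card, Fintype.card_fin] at this
      omega
    rw [hu]
    exact Set.univ_subset_iff.1 (hf _)

open P3Game

/-- The adjacency matrix of `e` is that of `G`. -/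
def Env.Codes (e : Env) (G : SimpleGraph (Fin e.n)) : Prop :=
  ∀ u v : Fin e.n, e.adj u v = 1 ↔ G.Adj u v

/-- The array `A` holds the set `S`. -/
def CodesSet {n : ℕ} (A : ℕ → ℕ → ℕ → ℕ) (S : Set (Fin n)) : Prop :=
  ∀ z : Fin n, A z z z = 1 ↔ z ∈ S

/-- The array `A` holds the sets `S y`. -/
def CodesFamily {n : ℕ} (A : ℕ → ℕ → ℕ → ℕ) (S : Fin n → Set (Fin n)) : Prop :=
  ∀ y z : Fin n, A y y z = 1 ↔ z ∈ S y

section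
variable {e : Env} {a i j : ℕ}

theorem Env.mem_iff {S : Set (Fin e.n)} (h : CodesSet (e.arr a) S) {z : Fin e.n}
    (hz : e.var i = z) : e.Mem a i ↔ z ∈ S := by
  rw [Env.Mem, Env.cell, hz, if_pos ⟨z.2, z.2, z.2⟩, h z]

theorem Env.rel_iff {S : Fin e.n → Set (Fin e.n)} (h : CodesFamily (e.arr a) S) {y z : Fin e.n}
    (hy : e.var i = y) (hz : e.var j = z) : e.Rel a i j ↔ z ∈ S y := by
  rw [Env.Rel, Env.cell, hy, hz, if_pos ⟨y.2, y.2, z.2⟩, h y z]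

theorem Env.adj_iff {G : SimpleGraph (Fin e.n)} (h : e.Codes G) {y z : Fin e.n}
    (hy : e.var i = y) (hz : e.var j = z) : e.Adj i j ↔ G.Adj y z := by
  rw [Env.Adj, hy, hz, h]

end

/-- The function with the value `1` where `Q` holds, and `0` elsewhere. -/
noncomputable def indicator (Q : Env → Prop) (e : Env) : ℕ :=
  open Classical in if Q e then 1 else 0

theorem indicator_eq_one {Q : Env → Prop} {e : Env} : indicator Q e = 1 ↔ Q e := by
  unfold indicator
  split_ifs with h <;> simp [h]

/-- The complement of the array `0` and the vertex in the variable `3`. -/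
def HullInit (e : Env) : Prop :=
  ¬ e.Mem 0 0 ∨ e.var 0 = e.var 3

/-- The array `0` and the vertices with two neighbours in it. -/
def HullStep (e : Env) : Prop :=
  e.Mem 0 0 ∨ ∃ y < e.n, ∃ z < e.n, y ≠ z ∧ ((e.push y).push z).Mem 0 1 ∧
    ((e.push y).push z).Mem 0 0 ∧ ((e.push y).push z).Adj 2 1 ∧ ((e.push y).push z).Adj 2 0

theorem comp_hullInit : Comp (indicator HullInit) :=
  (CompPred.mem 0 0).not.or (.varEq 0 3)

theorem comp_hullStep : Comp (indicator HullStep) := by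
  refine (CompPred.mem 0 0).or (CompPred.exists_lt (Q := fun e => ∃ z < e.n, e.var 0 ≠ z ∧
    (e.push z).Mem 0 1 ∧ (e.push z).Mem 0 0 ∧ (e.push z).Adj 2 1 ∧ (e.push z).Adj 2 0) ?_)
  exact CompPred.exists_lt (Q := fun e => e.var 1 ≠ e.var 0 ∧ e.Mem 0 1 ∧ e.Mem 0 0 ∧ e.Adj 2 1 ∧
    e.Adj 2 0) ((CompPred.varEq 1 0).not.and ((CompPred.mem 0 1).and ((CompPred.mem 0 0).and
      ((CompPred.adj 2 1).and (.adj 2 0)))))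

/-- The rounds never leave the hull, and a fixed point of the step is closed. -/
theorem hull_iterArr {e : Env} {G : SimpleGraph (Fin e.n)} (hG : e.Codes G) {C : Set (Fin e.n)}
    (hC : CodesSet (e.arr 0) C) {v : Fin e.n} (hv : e.var 0 = v) :
    CodesSet (e.iterArr (indicator HullInit) (indicator HullStep) e.n) (play G Cᶜ v) := by
  let f : Set (Fin e.n) → Set (Fin e.n) := fun S =>
    S ∪ {z | ∃ a b, a ≠ b ∧ a ∈ S ∧ b ∈ S ∧ G.Adj z a ∧ G.Adj z b}
  have key : ∀ t x y, ∀ z : Fin e.n,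
      e.iterArr (indicator HullInit) (indicator HullStep) t x y z = 1 ↔
        z ∈ f^[t] (insert v Cᶜ) := by
    intro t
    induction t with
    | zero =>
      intro x y z
      refine indicator_eq_one.trans ?_
      have h1 : (((e.push x).push y).push z).Mem 0 0 ↔ z ∈ C := 
        Env.mem_iff (a := 0) (e := ((e.push x).push y).push z) (z := z) hC rfl
      have h2 : (z : ℕ) = e.var 0 ↔ z = v := by rw [hv, Fin.ext_iff]
      exact (or_congr (not_congr h1) h2).trans or_comm
    | succ t ih =>
      intro x y z
      rw [Function.iterate_succ_apply']
      refine indicator_eq_one.trans ?_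
      have hA : CodesSet (e.iterArr (indicator HullInit) (indicator HullStep) t)
          (f^[t] (insert v Cᶜ)) := fun w => ih w w w
      set A := e.iterArr (indicator HullInit) (indicator HullStep) t
      refine or_congr (Env.mem_iff (a := 0) (e := (((e.pushArr A).push x).push y).push z) (z := z) hA rfl) ?_
      refine exists_lt_iff.trans (exists_congr fun a => exists_lt_iff.trans (exists_congr fun b => ?_))
      refine and_congr (not_congr Fin.ext_iff.symm) (and_congr ?_ (and_congr ?_ (and_congr ?_ ?_)))
      · exact Env.mem_iff (a := 0) (e := (((((e.pushArr A).push x).push y).push z).push a).push b) (z := a)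
          hA rfl
      · exact Env.mem_iff (a := 0) (e := (((((e.pushArr A).push x).push y).push z).push a).push b) (z := b)
          hA rfl
      · exact Env.adj_iff (e := (((((e.pushArr A).push x).push y).push z).push a).push b)
          (y := z) (z := a) hG rfl rfl
      · exact Env.adj_iff (e := (((((e.pushArr A).push x).push y).push z).push a).push b)
          (y := z) (z := b) hG rfl rfl
  intro z
  rw [key]
  have hf : ∀ S, S ⊆ f S := fun S => Set.subset_union_left
  have hsub : ∀ t, f^[t] (insert v Cᶜ) ⊆ play G Cᶜ v := by
    intro t
    induction t with
    | zero => exact insert_subset_play G _ _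
    | succ t ih =>
      rw [Function.iterate_succ_apply']
      refine Set.union_subset ih ?_
      rintro w ⟨a, b, hab, ha, hb, hwa, hwb⟩
      by_contra hw
      exact hab (closed_iff.1 (closed_play _ _) w hw a (ih ha) b (ih hb) hwa hwb)
  have hsup : ∀ t, insert v Cᶜ ⊆ f^[t] (insert v Cᶜ) := by
    intro t
    induction t with
    | zero => exact subset_rfl
    | succ t ih =>
      rw [Function.iterate_succ_apply']
      exact ih.trans (hf _)
  have hcl : Closed G (f^[e.n] (insert v Cᶜ)) := by
    rw [closed_iff]
    intro w hw a ha b hb hwa hwb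
    by_contra hab
    refine hw ?_
    rw [← iterate_fixed hf]
    exact .inr ⟨a, b, hab, ha, hb, hwa, hwb⟩
  exact ⟨fun h => hsub _ h, fun h => hull_subset hcl (hsup _) h⟩

/-- The vertices in the variables `0` and `1` are equal. -/
def ReachInit (e : Env) : Prop :=
  e.var 1 = e.var 0

/-- Extends the relation in the array `0` by an edge whose end does not belong to the array `1`. -/
def ReachStep (e : Env) : Prop :=
  e.Rel 0 1 0 ∨ (¬ e.Mem 1 0 ∧ ∃ w < e.n, (e.push w).Rel 0 2 0 ∧ (e.push w).Adj 0 1)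

theorem comp_reachInit : Comp (indicator ReachInit) :=
  CompPred.varEq 1 0

theorem comp_reachStep : Comp (indicator ReachStep) :=
  (CompPred.rel 0 1 0).or ((CompPred.mem 1 0).not.and
    (CompPred.exists_lt (Q := fun e => e.Rel 0 2 0 ∧ e.Adj 0 1)
      ((CompPred.rel 0 2 0).and (.adj 0 1))))

theorem reach_iterArr {e : Env} {G : SimpleGraph (Fin e.n)} (hG : e.Codes G) {M : Set (Fin e.n)}
    (hM : CodesSet (e.arr 0) M) :
    CodesFamily (e.iterArr (indicator ReachInit) (indicator ReachStep) e.n) (reach G M) := by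
  let f : Set (Fin e.n) → Set (Fin e.n) := fun S => S ∪ {z | z ∉ M ∧ ∃ w, w ∈ S ∧ G.Adj w z}
  have key : ∀ t x, ∀ y z : Fin e.n,
      e.iterArr (indicator ReachInit) (indicator ReachStep) t x y z = 1 ↔ z ∈ f^[t] {y} := by
    intro t
    induction t with
    | zero =>
      intro x y z
      refine indicator_eq_one.trans ?_
      exact Fin.ext_iff.symm.trans eq_comm
    | succ t ih =>
      intro x y z
      rw [Function.iterate_succ_apply']
      refine indicator_eq_one.trans ?_
      have hA : CodesFamily (e.iterArr (indicator ReachInit) (indicator ReachStep) t)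
          (fun y => f^[t] {y}) := fun y z => ih y y z
      set A := e.iterArr (indicator ReachInit) (indicator ReachStep) t
      refine or_congr (Env.rel_iff (a := 0) (e := (((e.pushArr A).push x).push y).push z) (y := y) (z := z)
        hA rfl rfl) (and_congr (not_congr ?_) (exists_lt_iff.trans (exists_congr fun w =>
          and_congr ?_ ?_)))
      · exact Env.mem_iff (a := 1) (e := (((e.pushArr A).push x).push y).push z) (z := z) hM rfl
      · exact Env.rel_iff (a := 0) (e := ((((e.pushArr A).push x).push y).push z).push w) (y := y) (z := w)
          hA rfl rfl
      · exact Env.adj_iff (e := ((((e.pushArr A).push x).push y).push z).push w) (y := w) (z := z)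
          hG rfl rfl
  intro y z
  rw [key]
  have hf : ∀ S, S ⊆ f S := fun S => Set.subset_union_left
  constructor
  · suffices ∀ t, f^[t] {y} ⊆ reach G M y from fun h => this _ h
    intro t
    induction t with
    | zero => exact Set.singleton_subset_iff.2 (self_mem_reach _ _)
    | succ t ih =>
      rw [Function.iterate_succ_apply']
      refine Set.union_subset ih ?_
      rintro w ⟨hw, a, ha, haw⟩
      exact reach_step (ih ha) haw hw
  · intro h
    induction h with
    | refl =>
      have : ∀ t, y ∈ f^[t] {y} := fun t => by
        induction t with
        | zero => rfl
        | succ t ih =>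
          rw [Function.iterate_succ_apply']
          exact hf _ ih
      exact this _
    | tail _ h ih =>
      rw [← iterate_fixed hf]
      exact .inr ⟨h.2, _, ih, h.1⟩

end RAM

namespace RAM

open P3Game

/-! ### The value of a position from the values of its components -/

/-- The vertex in the variable `1` is the least one of its component; the array `1` holds the labeled
vertices and the array `0` the components of the others. -/
def LeastVertex (e : Env) : Prop :=
  ¬ e.Mem 1 1 ∧ ∀ w < e.n, w < e.var 1 → ¬ (e.push w).Rel 0 2 0

/-- The vertices in the variables `1` and `0` are labeled, and no other labeled vertex has a neighbour
in the component of the vertex in the variable `3`. -/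
def BoundaryPair (e : Env) : Prop :=
  e.Mem 1 1 ∧ e.Mem 1 0 ∧ ∀ u < e.n, ∀ w < e.n, ((e.push u).push w).Mem 1 1 →
    ((e.push u).push w).Rel 0 5 0 → ((e.push u).push w).Adj 0 1 → u = e.var 1 ∨ u = e.var 0

/-- The entry of the table in the array `3` for the component of the vertex in the variable `1`. -/
noncomputable def componentValue : Env → ℕ :=
  Env.pick (fun e => ∃ u < e.n, BoundaryPair (e.push u)) (Env.pick BoundaryPair
    (Env.cell 3 (fun e => e.var 1) (fun e => e.var 0) fun e => e.var 3))

open Classical in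
/-- Adds the value of the component of the vertex in the variable `1` to the variable `0`. -/
noncomputable def addComponent (e : Env) : ℕ :=
  if LeastVertex e then Env.cell 4 (fun e => e.var 0) (fun e => e.var 0) componentValue e
  else e.var 0

/-- The nim sum of the values of the components. -/
noncomputable def sumValue (e : Env) : ℕ :=
  e.iter (fun _ => 0) addComponent e.n

theorem compPred_leastVertex : CompPred LeastVertex :=
  (CompPred.mem 1 1).not.and (CompPred.forall_lt (Q := fun e => e.var 0 < e.var 2 → ¬ e.Rel 0 2 0)
    ((CompPred.lt (.var 0) (.var 2)).imp (CompPred.rel 0 2 0).not))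

theorem compPred_boundaryPair : CompPred BoundaryPair := by
  refine (CompPred.mem 1 1).and ((CompPred.mem 1 0).and (CompPred.forall_lt (Q := fun e =>
    ∀ w < e.n, (e.push w).Mem 1 1 → (e.push w).Rel 0 5 0 → (e.push w).Adj 0 1 →
      e.var 0 = e.var 2 ∨ e.var 0 = e.var 1) ?_))
  exact CompPred.forall_lt (Q := fun e => e.Mem 1 1 → e.Rel 0 5 0 → e.Adj 0 1 →
    e.var 1 = e.var 3 ∨ e.var 1 = e.var 2) ((CompPred.mem 1 1).imp ((CompPred.rel 0 5 0).imp
      ((CompPred.adj 0 1).imp ((CompPred.varEq 1 3).or (.varEq 1 2)))))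

theorem comp_componentValue : Comp componentValue :=
  .pick compPred_boundaryPair.exists_lt
    (.pick compPred_boundaryPair (.arr 3 (.var 1) (.var 0) (.var 3)))

theorem comp_sumValue : Comp sumValue := by
  classical
  exact .iter (.const 0) (.cond compPred_leastVertex
    (.arr 4 (.var 0) (.var 0) comp_componentValue) (.var 0))

/-- The array `T` holds the values of the positions in which the unlabeled vertices form a component
with at most `t` vertices of the graph without `u₁` and `u₂`. -/
def ValueTable {n : ℕ} (G : SimpleGraph (Fin n)) (t : ℕ) (T : ℕ → ℕ → ℕ → ℕ) : Prop :=
  ∀ u₁ u₂ v : Fin n, Solid G (reach G {u₁, u₂} v)ᶜ → (reach G {u₁, u₂} v).ncard ≤ t →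
    T u₁ u₂ v = value G (reach G {u₁, u₂} v)ᶜ

section
variable {e : Env} {G : SimpleGraph (Fin e.n)} {M : Set (Fin e.n)}

theorem leastVertex_iff (hR : CodesFamily (e.arr 0) (reach G M)) (hM : CodesSet (e.arr 1) M)
    {v : Fin e.n} (hv : e.var 1 = v) : LeastVertex e ↔ IsLeast G M v := by
  refine and_congr (not_congr (Env.mem_iff hM hv)) (forall_lt_iff.trans (forall_congr' fun w => ?_))
  refine imp_congr (by rw [hv]; rfl) (not_congr ?_)
  exact Env.rel_iff (e := e.push w) (a := 0) (y := v) (z := w) hR hv rfl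

theorem boundaryPair_iff (hG : e.Codes G) (hR : CodesFamily (e.arr 0) (reach G M))
    (hM : CodesSet (e.arr 1) M) {u₁ u₂ v : Fin e.n} (h₁ : e.var 1 = u₁) (h₂ : e.var 0 = u₂)
    (hv : e.var 3 = v) : BoundaryPair e ↔
      u₁ ∈ M ∧ u₂ ∈ M ∧ ∀ u w, u ∈ M → w ∈ reach G M v → G.Adj w u → u = u₁ ∨ u = u₂ := by
  refine and_congr (Env.mem_iff hM h₁) (and_congr (Env.mem_iff hM h₂)
    (forall_lt_iff.trans (forall_congr' fun u => forall_lt_iff.trans (forall_congr' fun w => ?_))))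
  refine imp_congr ?_ (imp_congr ?_ (imp_congr ?_ (or_congr ?_ ?_)))
  · exact Env.mem_iff (e := (e.push u).push w) (a := 1) (z := u) hM rfl
  · exact Env.rel_iff (e := (e.push u).push w) (a := 0) (y := v) (z := w) hR hv rfl
  · exact Env.adj_iff (e := (e.push u).push w) (y := w) (z := u) hG rfl rfl
  · rw [h₁, Fin.ext_iff]
  · rw [h₂, Fin.ext_iff]

/-- Whichever boundary pair the search ends with, `reach_pair` identifies the component of its
entry, so all candidates give the same value. -/
theorem componentValue_eq (hcac : IsCactus G) (hG : e.Codes G) (hS : Solid G M)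
    (hR : CodesFamily (e.arr 0) (reach G M)) (hM : CodesSet (e.arr 1) M) {v : Fin e.n}
    (hv : e.var 1 = v) (hvM : v ∉ M) {t : ℕ} (hT : ValueTable G t (e.arr 3))
    (ht : (reach G M v).ncard ≤ t) : componentValue e = value G (reach G M v)ᶜ := by
  have hiff := fun u₁ u₂ : Fin e.n => boundaryPair_iff (e := (e.push u₁).push u₂) (u₁ := u₁)
    (u₂ := u₂) (v := v) hG hR hM rfl rfl hv
  obtain ⟨u₁, h₁, u₂, h₂, h⟩ := hS.exists_pair hcac hvM
  refine Env.pick_eq ⟨u₁, u₁.2, u₂, u₂.2, (hiff u₁ u₂).2 ⟨h₁, h₂, fun u w hu => h u hu w⟩⟩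
    fun i hi hQ => Env.pick_eq hQ fun j hj hp => ?_
  have hj : j < e.n := hj
  obtain ⟨h₁, h₂, h⟩ := (hiff ⟨i, hi⟩ ⟨j, hj⟩).1 hp
  have hr : reach G {⟨i, hi⟩, ⟨j, hj⟩} v = reach G M v := reach_pair h₁ h₂ fun u hu w => h u w hu
  have hc : Env.cell 3 (fun e => e.var 1) (fun e => e.var 0) (fun e => e.var 3)
      ((e.push i).push j) = e.arr 3 i j v := by
    have hlt : e.var 1 < e.n := hv ▸ v.2
    exact (if_pos ⟨hi, hj, hlt⟩).trans (congrArg (e.arr 3 i j) hv)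
  have hTv := hT ⟨i, hi⟩ ⟨j, hj⟩ v
  rw [hr] at hTv
  exact hc.trans (hTv (hS.compl_reach hvM) ht)

theorem sumValue_eq (hcac : IsCactus G) (hG : e.Codes G) (hS : Solid G M)
    (hR : CodesFamily (e.arr 0) (reach G M)) (hM : CodesSet (e.arr 1) M) {t : ℕ}
    (hT : ValueTable G t (e.arr 3)) (ht : Mᶜ.ncard ≤ t) (hX : NimTable e.n (e.arr 4)) :
    sumValue e = value G M := by
  -- Strict because `M` is nonempty. The two values combined below are bounded by sizes of disjoint
  -- parts of `Mᶜ`, so they add up to less than `n` and lie in the range of the nim table.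
  have hlt : Mᶜ.ncard < e.n := by
    have := Set.ncard_lt_card (s := Mᶜ) fun h => hS.nonempty.ne_empty (Set.compl_univ_iff.1 h)
    simpa using this
  have key : ∀ k ≤ e.n, e.iter (fun _ => 0) addComponent k = value G (reachBelow G M k)ᶜ := by
    intro k
    induction k with
    | zero =>
      intro _
      have : reachBelow G M 0 = ∅ := by
        ext w
        simp [reachBelow]
      rw [this, Set.compl_empty, value_univ]
      rfl
    | succ k ih =>
      intro hk
      let v : Fin e.n := ⟨k, hk⟩
      have ih := ih (by omega)
      have hl := leastVertex_iff (e := (e.push k).push (e.iter (fun _ => 0) addComponent k)) (v := v)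
        hR hM rfl
      change addComponent ((e.push k).push (e.iter (fun _ => 0) addComponent k)) = _
      by_cases hv : IsLeast G M v
      · have hsub : reachBelow G M k ∪ reach G M v ⊆ Mᶜ :=
          Set.union_subset (reachBelow_subset k) fun w => notMem_of_mem_reach hv.1
        have hcard : (reachBelow G M k ∪ reach G M v).ncard =
            (reachBelow G M k).ncard + (reach G M v).ncard :=
          Set.ncard_union_eq (disjoint_reachBelow v hv)
        have hle := Set.ncard_le_ncard hsub
        have hle' : (reach G M v).ncard ≤ t := by omega
        have hcv : componentValue ((e.push k).push (e.iter (fun _ => 0) addComponent k)) =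
            value G (reach G M v)ᶜ := componentValue_eq
          (e := (e.push k).push (e.iter (fun _ => 0) addComponent k)) (v := v)
            hcac hG hS hR hM rfl hv.1 hT hle'
        have h1 := value_le (G := G) (reachBelow G M k)ᶜ
        have h2 := value_le (G := G) (reach G M v)ᶜ
        rw [compl_compl] at h1 h2
        rw [addComponent, if_pos (hl.2 hv), Env.cell, hcv, if_pos]
        swap
        · simp only [Env.push_var_zero, Env.push_n, ih]
          omega
        · simp only [Env.push_var_zero, Env.push_arr, ih]
          rw [hX _ _ _ (by omega)]
          exact (value_reachBelow_succ hS.1 hS.nonempty v hv).symm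
      · rw [addComponent, if_neg (hl.not.2 hv)]
        exact ih.trans (by rw [← reachBelow_succ_of_not v hv])
  rw [sumValue, key _ le_rfl, reachBelow_size, compl_compl]

end

/-! ### The value of a position from the values of smaller ones -/

/-- The value of the position after the selection of the vertex in the variable `0`; the array `0`
holds the unlabeled vertices. -/
noncomputable def valueAfter (e : Env) : ℕ :=
  (fun e : Env => sumValue (e.pushArr (e.iterArr (indicator ReachInit) (indicator ReachStep) e.n)))
    (e.pushArr (e.iterArr (indicator HullInit) (indicator HullStep) e.n))

/-- The vertex in the variable `0` can be selected. -/
def LegalMove (e : Env) : Prop :=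
  e.Mem 0 0 ∧ ((∀ z < e.n, (e.push z).Mem 0 0) ∨ ∃ y < e.n, (y = e.var 0 ∨ (e.push y).Adj 1 0) ∧
    ∃ z < e.n, ¬ ((e.push y).push z).Mem 0 0 ∧ ((e.push y).push z).Adj 1 0)

/-- The value of a position; the array `0` holds the unlabeled vertices, the array `1` the table of
the values and the array `2` the table of the nim sums. -/
noncomputable def positionValue : Env → ℕ :=
  Env.mex fun e => ∃ x < e.n, LegalMove (e.push x) ∧ valueAfter (e.push x) = e.var 0

theorem comp_valueAfter : Comp valueAfter :=
  .iterArr comp_hullInit comp_hullStep (.iterArr comp_reachInit comp_reachStep comp_sumValue)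

theorem compPred_legalMove : CompPred LegalMove := by
  refine (CompPred.mem 0 0).and ((CompPred.forall_lt (.mem 0 0)).or (CompPred.exists_lt
    (Q := fun e => (e.var 0 = e.var 1 ∨ e.Adj 1 0) ∧
      ∃ z < e.n, ¬ (e.push z).Mem 0 0 ∧ (e.push z).Adj 1 0) ?_))
  exact ((CompPred.varEq 0 1).or (.adj 1 0)).and (CompPred.exists_lt
    (Q := fun e => ¬ e.Mem 0 0 ∧ e.Adj 1 0) ((CompPred.mem 0 0).not.and (.adj 1 0)))

theorem comp_positionValue : Comp positionValue :=
  .mex (CompPred.exists_lt (Q := fun e => LegalMove e ∧ valueAfter e = e.var 1)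
    (compPred_legalMove.and (.eq comp_valueAfter (.var 1))))

section
variable {e : Env} {G : SimpleGraph (Fin e.n)} {C : Set (Fin e.n)}

theorem legalMove_iff (hG : e.Codes G) (hC : CodesSet (e.arr 0) C) {x : Fin e.n}
    (hx : e.var 0 = x) : LegalMove e ↔ Move G Cᶜ x := by
  refine and_congr ((Env.mem_iff hC hx).trans (by simp)) (or_congr ?_ ?_)
  · rw [Set.compl_empty_iff, Set.eq_univ_iff_forall]
    exact forall_lt_iff.trans (forall_congr' fun z =>
      Env.mem_iff (e := e.push z) (a := 0) (z := z) hC rfl)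
  · refine exists_lt_iff.trans (exists_congr fun y => and_congr (or_congr ?_ ?_)
      (exists_lt_iff.trans (exists_congr fun z => and_congr (not_congr ?_) ?_)))
    · rw [hx, Fin.ext_iff]
    · exact Env.adj_iff (e := e.push y) (y := x) (z := y) hG hx rfl
    · exact Env.mem_iff (e := (e.push y).push z) (a := 0) (z := z) hC rfl
    · exact Env.adj_iff (e := (e.push y).push z) (y := y) (z := z) hG rfl rfl

/-- The selected vertex leaves the unlabeled part, so the components that remain have at most `t`
vertices and are covered by the table. -/
theorem valueAfter_eq (hcac : IsCactus G) (hG : e.Codes G) (hC : CodesSet (e.arr 0) C)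
    (hS : Cᶜ = ∅ ∨ Solid G Cᶜ) {t : ℕ} (hT : ValueTable G t (e.arr 1)) (ht : C.ncard ≤ t + 1)
    (hX : NimTable e.n (e.arr 2)) {x : Fin e.n} (hx : e.var 0 = x) (hm : Move G Cᶜ x) :
    valueAfter e = value G (play G Cᶜ x) := by
  have hM := hull_iterArr hG hC hx
  have hR := reach_iterArr
    (e := e.pushArr (e.iterArr (indicator HullInit) (indicator HullStep) e.n)) hG hM
  have hlt := ncard_compl_play_lt_of_notMem (G := G) hm.1
  rw [compl_compl] at hlt
  have hle : (play G Cᶜ x)ᶜ.ncard ≤ t := by omega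
  exact sumValue_eq (e := (e.pushArr (e.iterArr (indicator HullInit) (indicator HullStep) e.n)).pushArr
    (Env.iterArr (indicator ReachInit) (indicator ReachStep)
      (e.pushArr (e.iterArr (indicator HullInit) (indicator HullStep) e.n)) e.n))
    hcac hG (Solid.play hS hm) hR hM hT hle hX

theorem positionValue_eq (hcac : IsCactus G) (hG : e.Codes G) (hC : CodesSet (e.arr 0) C)
    (hS : Cᶜ = ∅ ∨ Solid G Cᶜ) {t : ℕ} (hT : ValueTable G t (e.arr 1)) (ht : C.ncard ≤ t + 1)
    (hX : NimTable e.n (e.arr 2)) : positionValue e = value G Cᶜ := by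
  refine Env.mex_eq ?_ ((value_le _).trans ?_)
  · convert value_isMex (G := G) Cᶜ using 1
    ext m
    refine exists_lt_iff.trans (exists_congr fun x => ?_)
    rw [legalMove_iff (e := (e.push m).push x) (x := x) hG hC rfl]
    refine and_congr_right fun hm => ?_
    rw [valueAfter_eq (e := (e.push m).push x) (x := x) hcac hG hC hS hT ht hX rfl hm]
    rfl
  · simpa using Set.ncard_le_card Cᶜᶜ

end

/-! ### The table of the values -/

/-- The vertex in the variable `0` is one of those in the variables `5` and `4`. -/
def IsDeleted (e : Env) : Prop :=
  e.var 0 = e.var 5 ∨ e.var 0 = e.var 4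

/-- The value of the position in which the unlabeled vertices form the component of the vertex in the
variable `0` in the graph without those in the variables `2` and `1`. -/
noncomputable def tableStep (e : Env) : ℕ :=
  (fun e : Env => (fun e : Env => (fun e : Env => positionValue { e with
      var := fun i => e.var (id i), arr := fun a => e.arr (if a = 0 then 0 else a + 2) })
    (e.pushArr fun x y z => indicator (Env.Rel 0 3 0) (((e.push x).push y).push z)))
    (e.pushArr (e.iterArr (indicator ReachInit) (indicator ReachStep) e.n)))
    (e.pushArr fun x y z => indicator IsDeleted (((e.push x).push y).push z))

/-- The Grundy value of the initial position. -/
noncomputable def initialValue (e : Env) : ℕ :=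
  (fun e : Env => (fun e : Env => positionValue (e.pushArr fun _ _ _ => 1))
    (e.pushArr (e.iterArr (fun _ => 0) tableStep e.n)))
    (e.pushArr (e.iterArr (fun _ => 0) (Env.mex NimExcluded) e.n))

theorem comp_tableStep : Comp tableStep :=
  .letArr (I := indicator IsDeleted) ((CompPred.varEq 0 5).or (.varEq 0 4))
    (.iterArr comp_reachInit comp_reachStep
      (.letArr (I := indicator (Env.Rel 0 3 0)) (CompPred.rel 0 3 0)
        (comp_positionValue.rename id fun a => if a = 0 then 0 else a + 2)))

theorem comp_initialValue : Comp initialValue :=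
  .iterArr (.const 0) (.mex compPred_nimExcluded)
    (.iterArr (.const 0) comp_tableStep (.letArr (.const 1) comp_positionValue))

section
variable {e : Env} {G : SimpleGraph (Fin e.n)}

theorem tableStep_eq (hcac : IsCactus G) (hG : e.Codes G) {t : ℕ}
    (hT : ValueTable G t (e.arr 0)) (hX : NimTable e.n (e.arr 1)) {u₁ u₂ v : Fin e.n}
    (h₁ : e.var 2 = u₁) (h₂ : e.var 1 = u₂) (hv : e.var 0 = v)
    (hS : Solid G (reach G {u₁, u₂} v)ᶜ) (ht : (reach G {u₁, u₂} v).ncard ≤ t + 1) :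
    tableStep e = value G (reach G {u₁, u₂} v)ᶜ := by
  have hM : CodesSet (fun x y z => indicator IsDeleted (((e.push x).push y).push z))
      ({u₁, u₂} : Set (Fin e.n)) := by
    intro z
    refine indicator_eq_one.trans (or_congr ?_ ?_)
    · exact (show (z : ℕ) = e.var 2 ↔ z = u₁ by rw [h₁, Fin.ext_iff])
    · exact (show (z : ℕ) = e.var 1 ↔ z = u₂ by rw [h₂, Fin.ext_iff])
  set A := fun x y z => indicator IsDeleted (((e.push x).push y).push z)
  have hR := reach_iterArr (e := e.pushArr A) hG hM
  set R := (e.pushArr A).iterArr (indicator ReachInit) (indicator ReachStep) (e.pushArr A).n with hRdef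
  have hC : CodesSet (fun x y z => indicator (Env.Rel 0 3 0)
      (((((e.pushArr A).pushArr R).push x).push y).push z)) (reach G {u₁, u₂} v) := by
    intro z
    refine indicator_eq_one.trans ?_
    exact Env.rel_iff (a := 0) (e := ((((e.pushArr A).pushArr R).push z).push z).push z) (y := v)
      (z := z) hR hv rfl
  set B := fun x y z => indicator (Env.Rel 0 3 0)
      (((((e.pushArr A).pushArr R).push x).push y).push z)
  let e' : Env := ((e.pushArr A).pushArr R).pushArr B
  -- The arrays are `B`, `R`, `A`, the values and the nim sums; the renaming skips `R` and `A`.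
  exact positionValue_eq (e := { e' with
      var := fun i => e'.var (id i), arr := fun a => e'.arr (if a = 0 then 0 else a + 2) })
    hcac hG hC (.inr hS) hT ht hX

theorem valueTable_iterArr (hcac : IsCactus G) (hG : e.Codes G) (hX : NimTable e.n (e.arr 0))
    (t : ℕ) : ValueTable G t (e.iterArr (fun _ => 0) tableStep t) := by
  induction t with
  | zero =>
    intro u₁ u₂ v _ ht
    have h0 := (Set.ncard_eq_zero (Set.toFinite _)).1 (Nat.le_zero.1 ht)
    -- A component contains its base vertex, so no entry is required in round zero.
    exact absurd (self_mem_reach (G := G) {u₁, u₂} v) (h0 ▸ Set.notMem_empty v)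
  | succ t ih =>
    intro u₁ u₂ v hS ht
    exact tableStep_eq (e := (((e.pushArr (e.iterArr (fun _ => 0) tableStep t)).push u₁).push
      u₂).push v) hcac hG ih hX rfl rfl rfl hS ht

/-- The empty position is not `Solid` and has no table entry; it is evaluated once at the end, and
every first move leads to a solid singleton. -/
theorem initialValue_eq (hcac : IsCactus G) (hG : e.Codes G) : initialValue e = value G ∅ := by
  have hX := nimTable_iterArr e
  set X := e.iterArr (fun _ => 0) (Env.mex NimExcluded) e.n
  have hT := valueTable_iterArr (e := e.pushArr X) hcac hG hX e.n
  rw [← Set.compl_univ]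
  refine positionValue_eq (e := ((e.pushArr X).pushArr
    ((e.pushArr X).iterArr (fun _ => 0) tableStep e.n)).pushArr fun _ _ _ => 1) hcac hG
    (fun z => iff_of_true rfl (Set.mem_univ _)) (.inl Set.compl_univ) hT ?_ hX
  simp

end

/-! ### The input as an argument list -/

/-- The arguments that the input represents. -/
noncomputable def inputEnv {n : ℕ} (G : SimpleGraph (Fin n)) : Env where
  n := n
  adj := (input G).arr 0
  var _ := 0
  arr _ _ _ _ := 0

theorem represents_input {n : ℕ} (G : SimpleGraph (Fin n)) :
    Represents (fun _ => 2) (fun _ => 1) (inputEnv G) (input G) where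
  size := rfl
  adj _ _ := rfl
  var _ := rfl
  arr _ _ _ _ _ _ _ := by simp [input, inputEnv]

theorem codes_inputEnv {n : ℕ} (G : SimpleGraph (Fin n)) : (inputEnv G).Codes G := by
  intro u v
  have : (∃ u' v' : Fin n, G.Adj u' v' ∧ u'.val = u.val ∧ v'.val = v.val) ↔ G.Adj u v := by
    constructor
    · rintro ⟨u', v', h, hu, hv⟩
      rwa [Fin.ext hu, Fin.ext hv] at h
    · exact fun h => ⟨u, v, h, rfl, rfl⟩
  simp only [inputEnv, input, true_and]
  rw [← this]
  split_ifs with h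
  · exact iff_of_true rfl h.2
  · exact iff_of_false (by simp) fun h' => h ⟨rfl, h'⟩

end RAM

open RAM Polynomial in
/-- There are a program and a polynomial `p` such that, for every cactus `G` with `n` vertices, the
program halts on input `G` after at most `p(n)` steps, register `0` then holds `1` if player one has a
winning strategy in the connected `P₃`-game on `G` and `0` if player two has one (exactly one of the
two is the case), and register `1` holds the Grundy value of the game. -/
theorem mainTheorem3 :
    ∃ (P : RAM.Program) (p : Polynomial ℕ), ∀ (n : ℕ) (G : SimpleGraph (Fin n)), IsCactus G →
      ∃ (t : ℕ) (m : RAM.Memory), RAM.Exec P (RAM.input G) t m ∧ t ≤ p.eval n ∧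
        ((P3Game.PlayerOneWins G ∧ ¬ P3Game.PlayerTwoWins G ∧ m.reg 0 = 1) ∨
          (P3Game.PlayerTwoWins G ∧ ¬ P3Game.PlayerOneWins G ∧ m.reg 0 = 0)) ∧
        m.reg 1 = P3Game.grundy G ∅ := by
  -- Register `2` and array `1` contain only zeros and stand for all arguments not in use; the
  -- result goes to register `3`.
  obtain ⟨P, p, hP⟩ := comp_initialValue (fun _ => 2) (fun _ => 1) 3 2 (by omega) (fun _ => by omega)
    (by omega) (fun _ => by omega)
  refine ⟨.seq P (.seq (.assign 1 (.reg 3))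
    (.cond (.reg 3) (.assign 0 (.const 1)) (.assign 0 (.const 0)))),
    p + (2 + (1 + (2 + 2) + 1) + 1) + 1, fun n G hG => ?_⟩
  have hval : initialValue (inputEnv G) = P3Game.grundy G ∅ := by
    have hcl : P3Game.Closed G ∅ :=
      P3Game.closed_iff.2 fun _ _ _ h => absurd h (Set.notMem_empty _)
    rw [P3Game.grundy_eq_value hcl fun h => absurd h Set.not_nonempty_empty]
    exact initialValue_eq (e := inputEnv G) hG (codes_inputEnv G)
  simp only [eval_add, eval_ofNat, eval_one]
  refine Halts.seq (hP _ _ (represents_input G)) ?_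
  rintro m ⟨hm, -⟩
  rw [hval] at hm
  refine Halts.seq (Φ := fun m' => m'.reg 1 = P3Game.grundy G ∅ ∧ m'.reg 3 = P3Game.grundy G ∅)
    (Halts.assign ⟨?_, ?_⟩) ?_
  · simpa [Memory.setReg, Term.eval] using hm
  · simpa [Memory.setReg, Term.eval] using hm
  rintro m' ⟨h1, h3⟩
  rw [P3Game.playerOneWins_iff, P3Game.playerTwoWins_iff]
  refine Halts.cond (fun h => Halts.assign ?_) fun h => Halts.assign ?_
  · simp only [Term.eval, h3] at h
    simp [Memory.setReg, Term.eval, h, h1]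
  · simp only [Term.eval, h3] at h
    simp [Memory.setReg, Term.eval, h, h1]
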